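/- **Setting.** Let $\mathcal M$ be a von Neumann algebra with a normal semifinite faithful trace $\tau$. Let $\mathcal S$ be the linear span of the positive $x\in\mathcal M$ whose support projection has finite trace, and let $L^1(\mathcal M)$ be the completion of $\mathcal S$ for $\|x\|_1=\tau(|x|)$, $|x|=(x^*x)^{1/2}$. For $m\in\mathcal M$ the functional $x\mapsto\tau(mx)$ is extended continuously from $\mathcal S$ to $L^1(\mathcal M)$. Let $\mathbb T$ be the unit circle with normalized Lebesgue measure $\sigma$, $\mathbb D$ the open unit disc, and $|I|=\sigma(I)$ for an arc $I\subset\mathbb T$ (of positive length). *Column and row spaces.* For a simple function $\varphi=\sum_j a_j\chi_{F_j}$ on $\mathbb T$ ($a_j\in\mathcal S$, finitely many disjoint measurable sets $F_j$) put $\|\varphi\|_{L^1_c}=\tau\big((\sum_j\sigma(F_j)a_j^*a_j)^{1/2}\big)$ and $\|\varphi\|_{L^1_r}=\tau\big((\sum_j\sigma(F_j)a_ja_j^*)^{1/2}\big)$. The completions $L^1(\mathcal M,L^2_c(\mathbb T))$, $L^1(\mathcal M,L^2_r(\mathbb T))$ for these norms are regarded as spaces of functions in $L^2(\mathbb T,L^1(\mathcal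 M))$. *Operator-valued Hardy spaces.* An $\mathcal M_c$-atom is an $a\in L^1(\mathcal M,L^2_c(\mathbb T))$ which is supported in an arc $I$ and satisfies $\int_I a\,d\sigma=0$ and $\|a\|_{L^1_c}\le|I|^{-1/2}$. The space $\mathrm H^1_c(\mathbb T,\mathcal M)$ consists of the $f\in L^1(\mathbb T,L^1(\mathcal M))$ of the form $f=\sum_k\lambda_ka_k$ (convergence in $L^1(\mathbb T,L^1(\mathcal M))$), where $\lambda_k\in\mathbb C$, $\sum_k|\lambda_k|<\infty$, and each $a_k$ is an $\mathcal M_c$-atom or a constant function with value in $L^1(\mathcal M)$ of norm less than $1$; $\|f\|_{\mathrm H^1_c}$ is the infimum of $\sum_k|\lambda_k|$ over all such decompositions. Let $\mathcal H^1_c(\mathbb T,\mathcal M)$ be the set of $f\in \mathrm H^1_c(\mathbb T,\mathcal M)$ whose Poisson integral $P[f](z)=\int_{\mathbb T}\frac{1-|z|^2}{|1-\bar zt|^2}f(t)\,d\sigma(t)$ is analytic in $\mathbb D$, i.e. $P[f](z)=\sum_{n\ge0}c_nz^n$ for all $z\in\mathbb D$, with $c_n\in L^1(\mathcal M)$ and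 convergence in norm. The spaces $\mathrm H^1_r$ and $\mathcal H^1_r$ are defined in the same way with row spaces in place of column spaces. Finally $\mathcal H^1_{cr}(\mathbb T,\mathcal M)=\mathcal H^1_c(\mathbb T,\mathcal M)+\mathcal H^1_r(\mathbb T,\mathcal M)$, with $\|f\|_{\mathcal H^1_{cr}}=\inf\{\|g\|_{\mathrm H^1_c}+\|h\|_{\mathrm H^1_r}\}$ over $f=g+h$, $g\in\mathcal H^1_c$, $h\in\mathcal H^1_r$. *Scalar Hardy spaces.* A classical $2$-atom is a scalar function $b$ on $\mathbb T$ supported in an arc $I$ with $\int_I b\,d\sigma=0$ and $\|b\|_{L^2}\le|I|^{-1/2}$. The space $\mathrm H^1(\mathbb T)$ consists of the sums $F=\sum_k\lambda_kb_k$ in $L^1(\mathbb T)$, where $\sum_k|\lambda_k|<\infty$ and each $b_k$ is a $2$-atom or a constant of modulus less than $1$; $\|F\|_{\mathrm H^1}$ is the infimum of $\sum_k|\lambda_k|$. The space $\mathcal H^1(\mathbb D)$ consists of the analytic functions $G$ in $\mathbb D$ with $\|G\|_{\mathcal H^1(\mathbb D)}=\sup_{0\le r<1}\int_{\mathbb T}|G(rt)|\,d\sigma(t)<\infty$.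 **Proposition 3.2.** Let $f\in\mathcal H^1_{cr}(\mathbb T,\mathcal M)$ and $m\in\mathcal M$, and let $\tau(mf)$ be the function $t\mapsto\tau(mf(t))$ in $L^1(\mathbb T)$. Then $\tau(mf)\in \mathrm H^1(\mathbb T)$, its Poisson integral $P[\tau(mf)]$ belongs to $\mathcal H^1(\mathbb D)$, and $$\|\tau(mf)\|_{\mathrm H^1}\le\|m\|_\infty\,\|f\|_{\mathcal H^1_{cr}},\qquad \|P[\tau(mf)]\|_{\mathcal H^1(\mathbb D)}\le\|m\|_\infty\,\|f\|_{\mathcal H^1_{cr}}.$$ -/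

import Mathlib

open scoped ENNReal NNReal
open Complex (I)
open Filter Topology MeasureTheory

set_option linter.unusedSectionVars false

namespace OpHardy

variable {M : Type*} [CStarAlgebra M] [PartialOrder M] [StarOrderedRing M]

/-- A normal semifinite faithful trace `τ : M₊ → [0, ∞]`. Only the values at positive elements are
constrained, and only these are ever used. Increasing nets are replaced by their ranges, which are
directed sets with the same supremum. -/
structure NSFTrace (M : Type*) [CStarAlgebra M] [PartialOrder M] [StarOrderedRing M] where
  toFun : M → ℝ≥0∞
  map_add : ∀ x y : M, 0 ≤ x → 0 ≤ y → toFun (x + y) = toFun x + toFun y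
  map_smul : ∀ (c : ℝ≥0) (x : M), 0 ≤ x → toFun ((c : ℝ) • x) = c * toFun x
  tracial : ∀ u : M, toFun (star u * u) = toFun (u * star u)
  normal : ∀ (D : Set M) (x : M), D.Nonempty → DirectedOn (· ≤ ·) D → (∀ d ∈ D, 0 ≤ d) →
    IsLUB D x → ⨆ d ∈ D, toFun d = toFun x
  semifinite : ∀ x : M, 0 ≤ x → x ≠ 0 → ∃ y : M, 0 ≤ y ∧ y ≤ x ∧ y ≠ 0 ∧ toFun y < ⊤
  faithful : ∀ x : M, 0 ≤ x → x ≠ 0 → 0 < toFun x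

namespace NSFTrace

instance : CoeFun (NSFTrace M) (fun _ => M → ℝ≥0∞) := ⟨NSFTrace.toFun⟩

variable (τ : NSFTrace M)

theorem map_zero : τ 0 = 0 := by
  have := τ.map_smul 0 0 le_rfl
  simpa using this

theorem mono {x y : M} (hx : 0 ≤ x) (hxy : x ≤ y) : τ x ≤ τ y := by
  have h := τ.map_add x (y - x) hx (sub_nonneg.2 hxy)
  rw [add_sub_cancel] at h
  rw [h]; exact le_self_add

theorem map_smul' {r : ℝ} (hr : 0 ≤ r) {x : M} (hx : 0 ≤ x) :
    τ (r • x) = ENNReal.ofReal r * τ x := by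
  have := τ.map_smul r.toNNReal x hx
  rw [Real.coe_toNNReal r hr] at this
  rw [this]; rfl

/-- Positive elements of finite trace. -/
def FinPos (x : M) : Prop := 0 ≤ x ∧ τ x < ⊤

variable {τ}

theorem FinPos.zero : τ.FinPos 0 := ⟨le_rfl, by simp [τ.map_zero]⟩

theorem FinPos.add {x y : M} (hx : τ.FinPos x) (hy : τ.FinPos y) : τ.FinPos (x + y) :=
  ⟨add_nonneg hx.1 hy.1, by
    rw [τ.map_add x y hx.1 hy.1]; exact ENNReal.add_lt_top.2 ⟨hx.2, hy.2⟩⟩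

theorem FinPos.smul {r : ℝ} (hr : 0 ≤ r) {x : M} (hx : τ.FinPos x) : τ.FinPos (r • x) :=
  ⟨smul_nonneg hr hx.1, by
    rw [τ.map_smul' hr hx.1]; exact ENNReal.mul_lt_top (by simp) hx.2⟩

theorem FinPos.toReal_add {x y : M} (hx : τ.FinPos x) (hy : τ.FinPos y) :
    (τ (x + y)).toReal = (τ x).toReal + (τ y).toReal := by
  rw [τ.map_add x y hx.1 hy.1, ENNReal.toReal_add hx.2.ne hy.2.ne]

theorem FinPos.toReal_smul {r : ℝ} (hr : 0 ≤ r) {x : M} (hx : τ.FinPos x) :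
    (τ (r • x)).toReal = r * (τ x).toReal := by
  rw [τ.map_smul' hr hx.1, ENNReal.toReal_mul, ENNReal.toReal_ofReal hr]

variable (τ)

/-- `x = (a - b) + i (c - d)` with `a, b, c, d` positive of finite trace. -/
def Decomp (x a b c d : M) : Prop :=
  τ.FinPos a ∧ τ.FinPos b ∧ τ.FinPos c ∧ τ.FinPos d ∧ x = (a - b) + I • (c - d)

/-- `(τ a - τ b) + i (τ c - τ d)`. -/
noncomputable def dval (a b c d : M) : ℂ :=
  (((τ a).toReal - (τ b).toReal : ℝ) : ℂ) + I * (((τ c).toReal - (τ d).toReal : ℝ) : ℂ)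

variable {τ}

theorem sub_eq_sub_val {a b a' b' : M} (ha : τ.FinPos a) (hb : τ.FinPos b) (ha' : τ.FinPos a')
    (hb' : τ.FinPos b') (h : a - b = a' - b') :
    (τ a).toReal - (τ b).toReal = (τ a').toReal - (τ b').toReal := by
  have h1 : a + b' = a' + b := by
    rw [sub_eq_sub_iff_add_eq_add] at h; exact h
  have h2 := congrArg (fun x => (τ x).toReal) h1
  simp only [ha.toReal_add hb', ha'.toReal_add hb] at h2
  linarith

theorem Decomp.star {x a b c d : M} (h : τ.Decomp x a b c d) :
    τ.Decomp (star x) a b d c := by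
  obtain ⟨ha, hb, hc, hd, rfl⟩ := h
  refine ⟨ha, hb, hd, hc, ?_⟩
  have e1 := ha.1.isSelfAdjoint.star_eq
  have e2 := hb.1.isSelfAdjoint.star_eq
  have e3 := hc.1.isSelfAdjoint.star_eq
  have e4 := hd.1.isSelfAdjoint.star_eq
  simp only [star_add, star_sub, star_smul, e1, e2, e3, e4, Complex.star_def, Complex.conj_I]
  module

theorem Decomp.re_eq {x a b c d : M} (h : τ.Decomp x a b c d) :
    a - b = (2⁻¹ : ℂ) • (x + Star.star x) := by
  have h' := h.star
  rw [h'.2.2.2.2, h.2.2.2.2]; module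

theorem Decomp.im_eq {x a b c d : M} (h : τ.Decomp x a b c d) :
    c - d = (2⁻¹ * -I : ℂ) • (x - Star.star x) := by
  have h' := h.star
  rw [h'.2.2.2.2, h.2.2.2.2]
  have : (a - b + I • (c - d) - (a - b + I • (d - c))) = (2 * I) • (c - d) := by module
  rw [this, smul_smul]
  have : (2⁻¹ * -I * (2 * I) : ℂ) = 1 := by
    have := Complex.I_mul_I
    linear_combination (-1 : ℂ) * this
  rw [this, one_smul]

theorem Decomp.dval_eq {x a b c d a' b' c' d' : M} (h : τ.Decomp x a b c d)
    (h' : τ.Decomp x a' b' c' d') : τ.dval a b c d = τ.dval a' b' c' d' := by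
  have e1 := sub_eq_sub_val h.1 h.2.1 h'.1 h'.2.1 (h.re_eq.trans h'.re_eq.symm)
  have e2 := sub_eq_sub_val h.2.2.1 h.2.2.2.1 h'.2.2.1 h'.2.2.2.1 (h.im_eq.trans h'.im_eq.symm)
  rw [dval, dval, e1, e2]

theorem Decomp.add {x a b c d x' a' b' c' d' : M} (h : τ.Decomp x a b c d)
    (h' : τ.Decomp x' a' b' c' d') :
    τ.Decomp (x + x') (a + a') (b + b') (c + c') (d + d') := by
  obtain ⟨ha, hb, hc, hd, rfl⟩ := h
  obtain ⟨ha', hb', hc', hd', rfl⟩ := h'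
  exact ⟨ha.add ha', hb.add hb', hc.add hc', hd.add hd', by module⟩

theorem Decomp.dval_add {x a b c d x' a' b' c' d' : M} (h : τ.Decomp x a b c d)
    (h' : τ.Decomp x' a' b' c' d') :
    τ.dval (a + a') (b + b') (c + c') (d + d') = τ.dval a b c d + τ.dval a' b' c' d' := by
  obtain ⟨ha, hb, hc, hd, -⟩ := h
  obtain ⟨ha', hb', hc', hd', -⟩ := h'
  simp only [dval, ha.toReal_add ha', hb.toReal_add hb', hc.toReal_add hc', hd.toReal_add hd']
  push_cast; ring

theorem Decomp.smul_nonneg {r : ℝ} (hr : 0 ≤ r) {x a b c d : M} (h : τ.Decomp x a b c d) :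
    τ.Decomp ((r : ℂ) • x) (r • a) (r • b) (r • c) (r • d) ∧
      τ.dval (r • a) (r • b) (r • c) (r • d) = r * τ.dval a b c d := by
  obtain ⟨ha, hb, hc, hd, rfl⟩ := h
  refine ⟨⟨ha.smul hr, hb.smul hr, hc.smul hr, hd.smul hr, ?_⟩, ?_⟩
  · simp only [← Complex.coe_smul r]
    module
  · simp only [dval, ha.toReal_smul hr, hb.toReal_smul hr, hc.toReal_smul hr, hd.toReal_smul hr]
    push_cast; ring

theorem Decomp.neg {x a b c d : M} (h : τ.Decomp x a b c d) :
    τ.Decomp (-x) b a d c ∧ τ.dval b a d c = - τ.dval a b c d := by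
  obtain ⟨ha, hb, hc, hd, rfl⟩ := h
  refine ⟨⟨hb, ha, hd, hc, by module⟩, ?_⟩
  simp only [dval]; push_cast; ring

theorem Decomp.I_smul {x a b c d : M} (h : τ.Decomp x a b c d) :
    τ.Decomp (I • x) d c a b ∧ τ.dval d c a b = I * τ.dval a b c d := by
  obtain ⟨ha, hb, hc, hd, rfl⟩ := h
  refine ⟨⟨hd, hc, ha, hb, ?_⟩, ?_⟩
  · rw [smul_add, smul_smul, Complex.I_mul_I]; module
  · simp only [dval]; push_cast
    linear_combination ((τ d).toReal - (τ c).toReal : ℂ) * Complex.I_mul_I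

theorem Decomp.smul_real (r : ℝ) {x a b c d : M} (h : τ.Decomp x a b c d) :
    ∃ a' b' c' d', τ.Decomp ((r : ℂ) • x) a' b' c' d' ∧
      τ.dval a' b' c' d' = r * τ.dval a b c d := by
  rcases le_total 0 r with hr | hr
  · exact ⟨_, _, _, _, h.smul_nonneg hr⟩
  · obtain ⟨h1, h2⟩ := h.smul_nonneg (neg_nonneg.2 hr)
    obtain ⟨h3, h4⟩ := h1.neg
    refine ⟨_, _, _, _, ?_, h4.trans ?_⟩
    · convert h3 using 1; push_cast; module
    · rw [h2]; push_cast; ring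

theorem Decomp.smul (z : ℂ) {x a b c d : M} (h : τ.Decomp x a b c d) :
    ∃ a' b' c' d', τ.Decomp (z • x) a' b' c' d' ∧
      τ.dval a' b' c' d' = z * τ.dval a b c d := by
  obtain ⟨_, _, _, _, h1, e1⟩ := h.smul_real z.re
  obtain ⟨_, _, _, _, h2, e2⟩ := h.I_smul.1.smul_real z.im
  refine ⟨_, _, _, _, ?_, (h1.dval_add h2).trans ?_⟩
  · convert h1.add h2 using 1
    rw [smul_smul, ← add_smul, Complex.re_add_im]
  · rw [e1, e2, h.I_smul.2]
    conv_rhs => rw [← Complex.re_add_im z]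
    ring

variable (τ)

/-- The definition ideal of the trace: the linear span of the positive elements of finite trace. -/
def defIdeal : Submodule ℂ M where
  carrier := {x | ∃ a b c d, τ.Decomp x a b c d}
  add_mem' := by
    rintro x y ⟨_, _, _, _, h⟩ ⟨_, _, _, _, h'⟩
    exact ⟨_, _, _, _, h.add h'⟩
  zero_mem' := ⟨0, 0, 0, 0, FinPos.zero, FinPos.zero, FinPos.zero, FinPos.zero, by simp⟩
  smul_mem' := by
    rintro z x ⟨_, _, _, _, h⟩
    obtain ⟨_, _, _, _, h1, -⟩ := h.smul z
    exact ⟨_, _, _, _, h1⟩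

open Classical in
/-- The linear extension of `τ` to `defIdeal τ` (and `0` outside of it): it sends
`(a - b) + i (c - d)` to `(τ a - τ b) + i (τ c - τ d)`, whatever the decomposition is,
see `Decomp.lin_eq`. -/
noncomputable def lin (x : M) : ℂ :=
  if h : ∃ p : M × M × M × M, τ.Decomp x p.1 p.2.1 p.2.2.1 p.2.2.2 then
    τ.dval h.choose.1 h.choose.2.1 h.choose.2.2.1 h.choose.2.2.2 else 0

variable {τ}

theorem Decomp.lin_eq {x a b c d : M} (h : τ.Decomp x a b c d) : τ.lin x = τ.dval a b c d := by
  have h' : ∃ p : M × M × M × M, τ.Decomp x p.1 p.2.1 p.2.2.1 p.2.2.2 := ⟨(a, b, c, d), h⟩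
  rw [lin, dif_pos h']
  exact Decomp.dval_eq h'.choose_spec h

theorem lin_add {x y : M} (hx : x ∈ τ.defIdeal) (hy : y ∈ τ.defIdeal) :
    τ.lin (x + y) = τ.lin x + τ.lin y := by
  obtain ⟨_, _, _, _, h⟩ := hx
  obtain ⟨_, _, _, _, h'⟩ := hy
  rw [(h.add h').lin_eq, h.lin_eq, h'.lin_eq, h.dval_add h']

theorem lin_smul (z : ℂ) {x : M} (hx : x ∈ τ.defIdeal) : τ.lin (z • x) = z * τ.lin x := by
  obtain ⟨_, _, _, _, h⟩ := hx
  obtain ⟨_, _, _, _, h1, e1⟩ := h.smul z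
  rw [h1.lin_eq, h.lin_eq, e1]

theorem lin_star {x : M} (hx : x ∈ τ.defIdeal) : τ.lin (star x) = star (τ.lin x) := by
  obtain ⟨_, _, _, _, h⟩ := hx
  rw [h.lin_eq, h.star.lin_eq]
  simp [dval]
  ring

theorem star_mem_defIdeal {x : M} (hx : x ∈ τ.defIdeal) : star x ∈ τ.defIdeal := by
  obtain ⟨_, _, _, _, h⟩ := hx
  exact ⟨_, _, _, _, h.star⟩

theorem FinPos.decomp {x : M} (hx : τ.FinPos x) : τ.Decomp x x 0 0 0 :=
  ⟨hx, FinPos.zero, FinPos.zero, FinPos.zero, by simp⟩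

theorem FinPos.mem {x : M} (hx : τ.FinPos x) : x ∈ τ.defIdeal := ⟨_, _, _, _, hx.decomp⟩

theorem FinPos.lin_eq {x : M} (hx : τ.FinPos x) : τ.lin x = ((τ x).toReal : ℂ) := by
  rw [hx.decomp.lin_eq]; simp [dval, τ.map_zero]

theorem finPos_of_mem {x : M} (hx : x ∈ τ.defIdeal) (h0 : 0 ≤ x) : τ.FinPos x := by
  obtain ⟨a, b, c, d, h⟩ := hx
  have e := h.re_eq
  rw [h0.isSelfAdjoint.star_eq] at e
  have e' : a - b = x := by rw [e]; module
  refine ⟨h0, lt_of_le_of_lt (τ.mono h0 ?_) h.1.2⟩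
  rw [← e']; exact sub_le_self _ h.2.1.1

theorem expand (u : ℂ) (y z : M) : star (z + u • y) * (z + u • y) =
    star z * z + star u • (star y * z) + u • (star z * y) + (u * star u) • (star y * y) := by
  simp only [star_add, star_smul, add_mul, mul_add, smul_mul_assoc, mul_smul_comm, smul_add,
    smul_smul]
  abel

/-- Arithmetic-geometric form of the Cauchy-Schwarz inequality. -/
theorem amgm {y z : M} (hy : τ (star y * y) < ⊤) (hz : τ (star z * z) < ⊤) :
    star y * z ∈ τ.defIdeal ∧
      ‖τ.lin (star y * z)‖ ≤ ((τ (star y * y)).toReal + (τ (star z * z)).toReal) / 2 := by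
  have fy : τ.FinPos (star y * y) := ⟨star_mul_self_nonneg y, hy⟩
  have fz : τ.FinPos (star z * z) := ⟨star_mul_self_nonneg z, hz⟩
  have key : ∀ u : ℂ, ‖u‖ = 1 → τ.FinPos (star (z + u • y) * (z + u • y)) := by
    intro u hu
    have h2 : (u * star u) = 1 := by
      rw [Complex.star_def, Complex.mul_conj, Complex.normSq_eq_norm_sq, hu]; simp
    have e : star (z + u • y) * (z + u • y) + star (z - u • y) * (z - u • y) =
        (star z * z + star y * y) + (star z * z + star y * y) := by
      have e1 : z - u • y = z + (-u) • y := by module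
      rw [e1, expand, expand, neg_mul, star_neg, mul_neg, neg_neg, h2]
      module
    refine ⟨star_mul_self_nonneg _, lt_of_le_of_lt (τ.mono (star_mul_self_nonneg _) ?_)
      ((fz.add fy).add (fz.add fy)).2⟩
    rw [← e]; exact le_add_of_nonneg_right (star_mul_self_nonneg _)
  have mem : star y * z ∈ τ.defIdeal := by
    have h1 := (key 1 (by simp)).mem
    have h2 := (key (-1) (by simp)).mem
    have h3 := (key I (by simp)).mem
    have h4 := (key (-I) (by simp)).mem
    have e : star y * z = (4⁻¹ : ℂ) • (star (z + (1 : ℂ) • y) * (z + (1 : ℂ) • y)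
        - star (z + (-1 : ℂ) • y) * (z + (-1 : ℂ) • y)
        + I • (star (z + I • y) * (z + I • y)) - I • (star (z + (-I) • y) * (z + (-I) • y))) := by
      have hII : I * I = -1 := Complex.I_mul_I
      simp only [star_add, star_smul, add_mul, mul_add, star_neg, one_smul, neg_smul,
        smul_mul_assoc, mul_smul_comm, smul_smul, Complex.star_def, Complex.conj_I, smul_add,
        mul_neg, neg_mul, hII, smul_neg]
      module
    rw [e]
    exact Submodule.smul_mem _ _ (Submodule.sub_mem _ (Submodule.add_mem _
      (Submodule.sub_mem _ h1 h2) (Submodule.smul_mem _ _ h3)) (Submodule.smul_mem _ _ h4))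
  refine ⟨mem, ?_⟩
  obtain ⟨u, hu, hu'⟩ : ∃ u : ℂ, ‖u‖ = 1 ∧ u * τ.lin (star y * z) = ‖τ.lin (star y * z)‖ := by
    by_cases h : τ.lin (star y * z) = 0
    · exact ⟨1, by simp, by simp [h]⟩
    · refine ⟨‖τ.lin (star y * z)‖ / τ.lin (star y * z), ?_, ?_⟩
      · rw [norm_div]; simp [h]
      · field_simp
  have h2 : (star u * u) = 1 := by
    rw [mul_comm, Complex.star_def, Complex.mul_conj, Complex.normSq_eq_norm_sq, hu]; simp
  have k := key (-star u) (by simpa using hu)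
  have e : star (z + (-star u) • y) * (z + (-star u) • y) + (u • (star y * z) + star (u • (star y * z)))
      = star z * z + star y * y := by
    have h3 : -star u * star (-star u) = 1 := by simpa using h2
    rw [expand, h3, star_smul, star_mul, star_star, star_neg, star_star]
    module
  have mu : u • (star y * z) ∈ τ.defIdeal := Submodule.smul_mem _ _ mem
  have e2 := congrArg τ.lin e
  rw [lin_add k.mem (Submodule.add_mem _ mu (star_mem_defIdeal mu)), lin_add mu (star_mem_defIdeal mu),
    lin_star mu, lin_smul _ mem, hu', (fz.add fy).lin_eq, k.lin_eq, fz.toReal_add fy] at e2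
  have e3 := congrArg Complex.re e2
  simp only [Complex.add_re, Complex.ofReal_re, Complex.star_def, Complex.conj_ofReal] at e3
  have : 0 ≤ (τ (star (z + (-star u) • y) * (z + (-star u) • y))).toReal := ENNReal.toReal_nonneg
  simp only [Complex.star_def] at this
  linarith

theorem conj_le (m : M) {w : M} :
    τ (star (star w * m) * (star w * m)) ≤ ENNReal.ofReal (‖m‖ ^ 2) * τ (star w * w) := by
  have e : star (star w * m) * (star w * m) = star (star w * m) * star (star (star w * m)) := by simp
  rw [e, ← τ.tracial, ← τ.map_smul' (by positivity) (star_mul_self_nonneg w)]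
  refine τ.mono (star_mul_self_nonneg _) ?_
  have := CStarAlgebra.star_left_conjugate_le_norm_smul (a := w) (b := m * star m)
    (IsSelfAdjoint.mul_star_self m)
  rw [CStarRing.norm_self_mul_star, ← pow_two] at this
  convert this using 1
  simp [mul_assoc]

/-- `|τ (m w b)| ≤ K` as soon as `‖m‖ ≤ 1` and `τ (w* w), τ (b* b) ≤ K`. -/
theorem lin_mul_mul_le (m : M) {w b : M} (hw : τ (star w * w) < ⊤) (hb : τ (star b * b) < ⊤) :
    m * w * b ∈ τ.defIdeal ∧ (‖m‖ ≤ 1 → ‖τ.lin (m * w * b)‖ ≤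
      ((τ (star w * w)).toReal + (τ (star b * b)).toReal) / 2) := by
  have h1 := conj_le (τ := τ) (star m) (w := w)
  have h2 : τ (star (star w * star m) * (star w * star m)) < ⊤ :=
    lt_of_le_of_lt h1 (ENNReal.mul_lt_top (by simp) hw)
  obtain ⟨h3, h4⟩ := amgm h2 hb
  have e : star (star w * star m) = m * w := by simp
  rw [e] at h3 h4
  refine ⟨h3, fun hm => h4.trans ?_⟩
  have h5 : τ (m * w * (star w * star m)) ≤ τ (star w * w) := by
    rw [e] at h1
    refine h1.trans ?_
    rw [norm_star]
    calc _ ≤ ENNReal.ofReal 1 * τ (star w * w) := by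
          gcongr; exact pow_le_one₀ (norm_nonneg _) hm
      _ = _ := by simp
  have := ENNReal.toReal_mono hw.ne h5
  gcongr

theorem cfc_mul' (b : M) {f g : ℝ → ℝ} (hf : Continuous f) (hg : Continuous g) :
    cfc (fun s => f s * g s) b = cfc f b * cfc g b :=
  cfc_mul f g b hf.continuousOn hg.continuousOn

theorem cfc_sub' (b : M) {f g : ℝ → ℝ} (hf : Continuous f) (hg : Continuous g) :
    cfc (fun s => f s - g s) b = cfc f b - cfc g b :=
  cfc_sub f g b hf.continuousOn hg.continuousOn

/-- The function `s / (s ^ 2 + η ^ 2)`. -/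
noncomputable def auxG (η s : ℝ) : ℝ := s / (s * s + η * η)

/-- The function `1 / (|s| + η)`. -/
noncomputable def auxF (η s : ℝ) : ℝ := (|s| + η)⁻¹

theorem continuous_auxG {η : ℝ} (hη : 0 < η) : Continuous (auxG η) := by
  unfold auxG
  exact continuous_id.div (by fun_prop) fun s => by
    have := mul_self_nonneg s; positivity

theorem continuous_auxF {η : ℝ} (hη : 0 < η) : Continuous (auxF η) := by
  unfold auxF
  exact Continuous.inv₀ (by fun_prop) fun s => by positivity

theorem auxG_one {η s : ℝ} (hη : 0 < η) (hs : 0 ≤ s) : |s * s * auxG η s - s| ≤ η := by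
  have hd : 0 < s * s + η * η := by positivity
  have h1 : s * s * auxG η s - s = - (s * (η * η) / (s * s + η * η)) := by
    unfold auxG; field_simp; ring
  rw [h1, abs_neg, abs_of_nonneg (by positivity), div_le_iff₀ hd]
  nlinarith [mul_nonneg hη.le (sq_nonneg (s - η)), mul_nonneg hs (mul_pos hη hη).le,
      mul_nonneg hη.le (sq_nonneg s), mul_nonneg hη.le (sq_nonneg η)]

theorem auxG_two {η s : ℝ} (hη : 0 < η) (hs : 0 ≤ s) :
    |s * s * (auxG η s * s - 1)| ≤ η * η := by
  have hd : 0 < s * s + η * η := by positivity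
  have h1 : s * s * (auxG η s * s - 1) = - (s * s * (η * η) / (s * s + η * η)) := by
    unfold auxG; field_simp; ring
  rw [h1, abs_neg, abs_of_nonneg (by positivity), div_le_iff₀ hd]
  nlinarith [mul_pos hη hη, mul_pos (mul_pos hη hη) (mul_pos hη hη)]

theorem auxG_three {η s : ℝ} (hη : 0 < η) (hs : 0 ≤ s) :
    |auxG η s * ((s * s) * (s * s)) * auxG η s - s * s| ≤ 2 * (η * η) := by
  have hd : 0 < s * s + η * η := by positivity
  have h1 : auxG η s * ((s * s) * (s * s)) * auxG η s - s * s =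
      - (s * s * (η * η) * (2 * (s * s) + η * η) / (s * s + η * η) ^ 2) := by
    unfold auxG; field_simp; ring
  rw [h1, abs_neg, abs_of_nonneg (by positivity), div_le_iff₀ (by positivity)]
  have h3 : 0 ≤ s * s := mul_self_nonneg s
  have h4 : 0 < η * η := by positivity
  clear h1
  generalize s * s = S at *
  generalize η * η = E at *
  have h5 : S * (2 * S + E) ≤ 2 * (S + E) ^ 2 := by nlinarith
  nlinarith

theorem norm_mul_cfc_le (x b : M) (hb : 0 ≤ b) (q : ℝ → ℝ) (hq : Continuous q)
    (hx : star x * x = cfc (fun s => q s * q s) b) (f : ℝ → ℝ) (hf : Continuous f) (K : ℝ)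
    (hK : 0 ≤ K) (h : ∀ s, 0 ≤ s → |q s * f s| ≤ K) : ‖x * cfc f b‖ ≤ K := by
  have hsa : IsSelfAdjoint b := hb.isSelfAdjoint
  have e : star (x * cfc f b) * (x * cfc f b) = cfc (fun s => (q s * f s) * (q s * f s)) b := by
    have e1 : star (cfc f b) = cfc f b := (cfc_predicate f b : IsSelfAdjoint _).star_eq
    rw [star_mul, e1, mul_assoc, ← mul_assoc (star x), hx, ← cfc_mul .., ← cfc_mul ..]
    congr 1; ext s; ring
  have h2 : ‖x * cfc f b‖ * ‖x * cfc f b‖ ≤ K * K := by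
    rw [← CStarRing.norm_star_mul_self, e]
    refine norm_cfc_le (by positivity) fun s hs => ?_
    have := h s (spectrum_nonneg_of_nonneg hb hs)
    rw [Real.norm_eq_abs, abs_mul]
    exact mul_le_mul this this (abs_nonneg _) hK
  exact le_of_sq_le_sq (by simpa [pow_two] using h2) hK

theorem exists_factor (x : M) : ∃ w b : M, w * b = x ∧ star w * w = CFC.abs x ∧
    star b * b = CFC.abs x := by
  have ha : 0 ≤ CFC.abs x := CFC.abs_nonneg x
  set b := CFC.sqrt (CFC.abs x) with hbdef
  have hb : 0 ≤ b := CFC.sqrt_nonneg _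
  have hsa : IsSelfAdjoint b := hb.isSelfAdjoint
  have hbb : b * b = CFC.abs x := CFC.sqrt_mul_sqrt_self _ ha
  have hb1 : cfc (fun s : ℝ => s) b = b := cfc_id' ℝ b
  have hb2 : cfc (fun s : ℝ => s * s) b = CFC.abs x := by
    rw [cfc_mul .., hb1, hbb]
  have hxx : star x * x = cfc (fun s : ℝ => (s * s) * (s * s)) b := by
    rw [cfc_mul .., hb2, CFC.abs_mul_abs]
  let η : ℕ → ℝ := fun n => 1 / ((n : ℝ) + 1)
  have hη : ∀ n, 0 < η n := fun n => by positivity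
  have hη0 : Filter.Tendsto η Filter.atTop (nhds 0) := tendsto_one_div_add_atTop_nhds_zero_nat
  have hg : ∀ n, Continuous (auxG (η n)) := fun n => continuous_auxG (hη n)
  have hid : Continuous (fun s : ℝ => s) := continuous_id
  have hsq : Continuous (fun s : ℝ => s * s) := by fun_prop
  have h4 : Continuous (fun s : ℝ => (s * s) * (s * s)) := by fun_prop
  let w : ℕ → M := fun n => x * cfc (auxG (η n)) b
  have hdist : ∀ n m, ‖w n - w m‖ ≤ η n + η m := by
    intro n m
    have : w n - w m = x * cfc (fun s => auxG (η n) s - auxG (η m) s) b := by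
      rw [cfc_sub' b (hg n) (hg m), mul_sub]
    rw [this]
    refine norm_mul_cfc_le x b hb (fun s => s * s) hsq hxx _ ((hg n).sub (hg m)) _
      (add_nonneg (hη n).le (hη m).le) fun s hs => ?_
    have e1 := abs_le.1 (auxG_one (hη n) hs)
    have e2 := abs_le.1 (auxG_one (hη m) hs)
    change |s * s * (auxG (η n) s - auxG (η m) s)| ≤ _
    rw [abs_le, mul_sub]; constructor <;> linarith
  have hc : CauchySeq w := by
    refine Metric.cauchySeq_iff'.2 fun ε hε => ?_
    obtain ⟨N, hN⟩ := (Metric.tendsto_atTop.1 hη0 (ε / 2) (by positivity))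
    refine ⟨N, fun n hn => ?_⟩
    rw [dist_eq_norm]
    have h1 := hN n hn
    have h2 := hN N le_rfl
    rw [Real.dist_eq, sub_zero, abs_of_pos (hη _)] at h1 h2
    linarith [hdist n N]
  obtain ⟨W, hW⟩ := cauchySeq_tendsto_of_complete hc
  refine ⟨W, b, ?_, ?_, ?_⟩
  · refine tendsto_nhds_unique (hW.mul_const b) ?_
    rw [tendsto_iff_norm_sub_tendsto_zero]
    have h2 : Filter.Tendsto (fun n => η n * η n) Filter.atTop (nhds 0) := by
      simpa using hη0.mul hη0
    refine squeeze_zero (fun _ => norm_nonneg _) (fun n => ?_) h2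
    have e : w n * b - x = x * cfc (fun s => auxG (η n) s * s - 1) b := by
      have hgi : Continuous (fun s => auxG (η n) s * s) := (hg n).mul hid
      rw [cfc_sub' b hgi continuous_const, cfc_mul' b (hg n) hid, hb1,
        cfc_const_one ℝ b, mul_sub, mul_one, ← mul_assoc]
    rw [e]
    exact norm_mul_cfc_le x b hb (fun s => s * s) hsq hxx _
      (((hg n).mul hid).sub continuous_const) _ (mul_self_nonneg _)
      fun s hs => auxG_two (hη n) hs
  · refine tendsto_nhds_unique ((hW.star).mul hW) ?_
    rw [tendsto_iff_norm_sub_tendsto_zero]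
    have h2 : Filter.Tendsto (fun n => 2 * (η n * η n)) Filter.atTop (nhds 0) := by
      simpa using (hη0.mul hη0).const_mul 2
    refine squeeze_zero (fun _ => norm_nonneg _) (fun n => ?_) h2
    have e : star (w n) * w n - CFC.abs x =
        cfc (fun s => auxG (η n) s * ((s * s) * (s * s)) * auxG (η n) s - s * s) b := by
      have e1 : star (cfc (auxG (η n)) b) = cfc (auxG (η n)) b :=
        (cfc_predicate (auxG (η n)) b : IsSelfAdjoint _).star_eq
      have hg4 : Continuous (fun s => auxG (η n) s * ((s * s) * (s * s))) := (hg n).mul h4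
      have hg5 : Continuous (fun s => auxG (η n) s * ((s * s) * (s * s)) * auxG (η n) s) :=
        hg4.mul (hg n)
      rw [cfc_sub' b hg5 hsq, hb2, cfc_mul' b hg4 (hg n),
        cfc_mul' b (hg n) h4, ← hxx]
      simp only [w, star_mul, e1, mul_assoc]
    rw [e]
    refine norm_cfc_le (mul_nonneg (by norm_num) (mul_self_nonneg _)) fun s hs => ?_
    exact auxG_three (hη n) (spectrum_nonneg_of_nonneg hb hs)
  · rw [hsa.star_eq, hbb]

theorem mul_mem_defIdeal (m : M) {x : M} (hx : x ∈ τ.defIdeal) : m * x ∈ τ.defIdeal := by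
  have key : ∀ a, τ.FinPos a → m * a ∈ τ.defIdeal := by
    intro a ha
    have e : star (CFC.sqrt a) * CFC.sqrt a = a := by
      rw [(CFC.sqrt_nonneg a).isSelfAdjoint.star_eq, CFC.sqrt_mul_sqrt_self a ha.1]
    have h := (lin_mul_mul_le (τ := τ) m (w := CFC.sqrt a) (b := CFC.sqrt a) (by rw [e]; exact ha.2)
      (by rw [e]; exact ha.2)).1
    rwa [mul_assoc, CFC.sqrt_mul_sqrt_self a ha.1] at h
  obtain ⟨a, b, c, d, ha, hb, hc, hd, rfl⟩ := hx
  rw [mul_add, mul_smul_comm, mul_sub, mul_sub]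
  exact Submodule.add_mem _ (Submodule.sub_mem _ (key a ha) (key b hb))
    (Submodule.smul_mem _ _ (Submodule.sub_mem _ (key c hc) (key d hd)))

theorem FinPos.lin_mul_le {a : M} (ha : τ.FinPos a) {m : M} (hm : ‖m‖ ≤ 1) :
    ‖τ.lin (m * a)‖ ≤ (τ a).toReal := by
  have e : star (CFC.sqrt a) * CFC.sqrt a = a := by
    rw [(CFC.sqrt_nonneg a).isSelfAdjoint.star_eq, CFC.sqrt_mul_sqrt_self a ha.1]
  have h := (lin_mul_mul_le (τ := τ) m (w := CFC.sqrt a) (b := CFC.sqrt a) (by rw [e]; exact ha.2)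
    (by rw [e]; exact ha.2)).2 hm
  rwa [mul_assoc, CFC.sqrt_mul_sqrt_self a ha.1, e, add_self_div_two] at h

/-- If `|τ (v x)| ≤ K` for all contractions `v`, then `τ |x| ≤ K`. -/
theorem abs_le_of_forall {x : M} (hx : x ∈ τ.defIdeal) {K : ℝ}
    (h : ∀ v : M, ‖v‖ ≤ 1 → ‖τ.lin (v * x)‖ ≤ K) : τ (CFC.abs x) ≤ ENNReal.ofReal K := by
  set a := CFC.abs x with hadef
  have ha : 0 ≤ a := CFC.abs_nonneg x
  have hsa : IsSelfAdjoint a := ha.isSelfAdjoint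
  have ha1 : cfc (fun s : ℝ => s) a = a := cfc_id' ℝ a
  have hxx : star x * x = cfc (fun s : ℝ => s * s) a := by
    rw [cfc_mul .., ha1, CFC.abs_mul_abs]
  have hf : ∀ η, 0 < η → Continuous (auxF η) := fun η hη => continuous_auxF hη
  have hid : Continuous (fun s : ℝ => s) := continuous_id
  have hsq : Continuous (fun s : ℝ => s * s) := by fun_prop
  let d : ℝ → M := fun η => cfc (fun s => auxF η s * (s * s)) a
  have hd0 : ∀ η, 0 < η → 0 ≤ d η := fun η hη => cfc_nonneg fun s hs => by
    simp only [auxF]; have := mul_self_nonneg s; positivity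
  have hdv : ∀ η, 0 < η → d η = star (x * cfc (auxF η) a) * x := by
    intro η hη
    have hc := hf η hη
    have e1 : star (cfc (auxF η) a) = cfc (auxF η) a :=
      (cfc_predicate (auxF η) a : IsSelfAdjoint _).star_eq
    simp only [d]
    rw [cfc_mul' a (hf η hη) hsq, ← hxx, star_mul, e1, mul_assoc]
  have hτd : ∀ η, 0 < η → τ (d η) ≤ ENNReal.ofReal K := by
    intro η hη
    have hv : ‖star (x * cfc (auxF η) a)‖ ≤ 1 := by
      rw [norm_star]
      refine norm_mul_cfc_le x a ha (fun s => s) (by fun_prop) hxx _ (hf η hη) 1 (by norm_num)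
        fun s hs => ?_
      simp only [auxF]
      rw [abs_of_nonneg hs, abs_of_nonneg (by positivity), ← div_eq_mul_inv,
        div_le_one (by positivity)]
      linarith
    have hfin : τ.FinPos (d η) := finPos_of_mem (by rw [hdv η hη]; exact mul_mem_defIdeal _ hx)
      (hd0 η hη)
    have := h _ hv
    rw [← hdv η hη, hfin.lin_eq, Complex.norm_real, Real.norm_eq_abs,
      abs_of_nonneg ENNReal.toReal_nonneg] at this
    exact ENNReal.le_ofReal_iff_toReal_le hfin.2.ne (ENNReal.toReal_nonneg.trans this) |>.2 this
  have hmono : ∀ η η', 0 < η → η ≤ η' → d η' ≤ d η := by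
    intro η η' hη hη'
    have h1 := hf η hη
    have h2 := hf η' (hη.trans_le hη')
    refine cfc_mono (hf := (h2.mul hsq).continuousOn) (hg := (h1.mul hsq).continuousOn)
      fun s hs => ?_
    simp only [auxF]
    have := mul_self_nonneg s
    gcongr
  have hle : ∀ η, 0 < η → d η ≤ a := by
    intro η hη
    have h1 := hf η hη
    conv_rhs => rw [← ha1]
    refine cfc_mono (hf := (h1.mul hsq).continuousOn) (hg := hid.continuousOn) fun s hs => ?_
    have hs0 := spectrum_nonneg_of_nonneg ha hs
    simp only [auxF]
    rw [abs_of_nonneg hs0, inv_mul_le_iff₀ (by positivity)]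
    nlinarith
  rw [← τ.normal (d '' Set.Ioi 0) a ⟨d 1, 1, by simp, rfl⟩ ?_ ?_ ?_]
  · refine iSup₂_le ?_
    rintro _ ⟨η, hη, rfl⟩
    exact hτd η hη
  · rintro _ ⟨η, hη, rfl⟩ _ ⟨η', hη', rfl⟩
    have : 0 < min η η' := lt_min hη hη'
    exact ⟨d (min η η'), ⟨_, this, rfl⟩, hmono _ _ this (min_le_left _ _),
      hmono _ _ this (min_le_right _ _)⟩
  · rintro _ ⟨η, hη, rfl⟩
    exact hd0 η hη
  · refine ⟨?_, fun c hc => ?_⟩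
    · rintro _ ⟨η, hη, rfl⟩
      exact hle η hη
    · have hlim : Filter.Tendsto (fun n : ℕ => d (1 / ((n : ℝ) + 1))) Filter.atTop (nhds a) := by
        rw [tendsto_iff_norm_sub_tendsto_zero]
        refine squeeze_zero (fun _ => norm_nonneg _) (fun n => ?_)
          tendsto_one_div_add_atTop_nhds_zero_nat
        have hη : 0 < 1 / ((n : ℝ) + 1) := by positivity
        generalize 1 / ((n : ℝ) + 1) = η at *
        have h1 := hf η hη
        have e : d η - a = cfc (fun s => auxF η s * (s * s) - s) a := by
          have h5 : Continuous (fun s => auxF η s * (s * s)) := h1.mul hsq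
          rw [cfc_sub' a h5 hid, ha1]
        rw [e]
        refine norm_cfc_le hη.le fun s hs => ?_
        have hs0 := spectrum_nonneg_of_nonneg ha hs
        have h3 : auxF η s * (s * s) - s = - (s * η / (s + η)) := by
          simp only [auxF]; rw [abs_of_nonneg hs0]
          have : s + η ≠ 0 := by positivity
          field_simp; ring
        rw [h3, norm_neg, Real.norm_eq_abs, abs_of_nonneg (by positivity),
          div_le_iff₀ (by positivity)]
        nlinarith
      exact le_of_tendsto' hlim fun n => hc ⟨_, by simp only [Set.mem_Ioi]; positivity, rfl⟩

theorem abs_lt_top {x : M} (hx : x ∈ τ.defIdeal) : τ (CFC.abs x) < ⊤ := by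
  have hx' := hx
  obtain ⟨a, b, c, d, ha, hb, hc, hd, e⟩ := hx'
  refine lt_of_le_of_lt (abs_le_of_forall hx (K := (τ a).toReal + (τ b).toReal +
    ((τ c).toReal + (τ d).toReal)) fun v hv => ?_) ENNReal.ofReal_lt_top
  have m1 := mul_mem_defIdeal v ha.mem
  have m2 := mul_mem_defIdeal v hb.mem
  have m3 := mul_mem_defIdeal v hc.mem
  have m4 := mul_mem_defIdeal v hd.mem
  have hsub : ∀ {p q : M}, p ∈ τ.defIdeal → q ∈ τ.defIdeal →
      τ.lin (p - q) = τ.lin p - τ.lin q := by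
    intro p q hp hq
    have : p - q = p + (-1 : ℂ) • q := by module
    rw [this, lin_add hp (Submodule.smul_mem _ _ hq), lin_smul _ hq]; ring
  rw [e, mul_add, mul_smul_comm, mul_sub, mul_sub, lin_add (Submodule.sub_mem _ m1 m2)
    (Submodule.smul_mem _ _ (Submodule.sub_mem _ m3 m4)), lin_smul _ (Submodule.sub_mem _ m3 m4),
    hsub m1 m2, hsub m3 m4]
  refine (norm_add_le _ _).trans (add_le_add ((norm_sub_le _ _).trans
    (add_le_add (ha.lin_mul_le hv) (hb.lin_mul_le hv))) ?_)
  rw [norm_mul, Complex.norm_I, one_mul]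
  exact (norm_sub_le _ _).trans (add_le_add (hc.lin_mul_le hv) (hd.lin_mul_le hv))

theorem lin_mul_le_abs {x : M} (hx : x ∈ τ.defIdeal) (m : M) :
    ‖τ.lin (m * x)‖ ≤ ‖m‖ * (τ (CFC.abs x)).toReal := by
  have key : ∀ v : M, ‖v‖ ≤ 1 → ‖τ.lin (v * x)‖ ≤ (τ (CFC.abs x)).toReal := by
    intro v hv
    obtain ⟨w, b, e1, e2, e3⟩ := exists_factor x
    have ht := abs_lt_top hx
    have := (lin_mul_mul_le (τ := τ) v (w := w) (b := b) (by rw [e2]; exact ht)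
      (by rw [e3]; exact ht)).2 hv
    rwa [e2, e3, mul_assoc, e1, add_self_div_two] at this
  rcases eq_or_ne m 0 with rfl | hm
  · have : τ.lin 0 = 0 := by
      have := lin_smul (τ := τ) 0 (Submodule.zero_mem _)
      simpa using this
    simp [this]
  · have hm' : (‖m‖ : ℂ) ≠ 0 := by simpa using hm
    have h1 := key ((‖m‖ : ℂ)⁻¹ • m) (by rw [norm_smul]; simp [hm])
    have h2 : m * x = (‖m‖ : ℂ) • (((‖m‖ : ℂ)⁻¹ • m) * x) := by
      rw [smul_mul_assoc, smul_smul, mul_inv_cancel₀ hm', one_smul]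
    rw [h2, lin_smul _ (mul_mem_defIdeal _ hx), norm_mul]
    simp only [Complex.norm_real, norm_norm]
    gcongr

theorem abs_add_le {x y : M} (hx : x ∈ τ.defIdeal) (hy : y ∈ τ.defIdeal) :
    (τ (CFC.abs (x + y))).toReal ≤ (τ (CFC.abs x)).toReal + (τ (CFC.abs y)).toReal := by
  refine ENNReal.toReal_le_of_le_ofReal (by positivity)
    (abs_le_of_forall (Submodule.add_mem _ hx hy) fun v hv => ?_)
  rw [mul_add, lin_add (mul_mem_defIdeal v hx) (mul_mem_defIdeal v hy)]
  refine (norm_add_le _ _).trans (add_le_add ?_ ?_)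
  · exact (lin_mul_le_abs hx v).trans (mul_le_of_le_one_left ENNReal.toReal_nonneg hv)
  · exact (lin_mul_le_abs hy v).trans (mul_le_of_le_one_left ENNReal.toReal_nonneg hv)

/-- `p` is the support of `x ≥ 0`: the least projection with `p x = x`. -/
def IsSupport (x p : M) : Prop := IsLeast {q : M | IsStarProjection q ∧ q * x = x} p

variable (τ)

/-- Positive elements with support of finite trace. -/
def suppFinite : Set M := {x | 0 ≤ x ∧ ∃ p, IsSupport x p ∧ τ p < ⊤}

/-- The linear span of the positive elements with support of finite trace. -/
noncomputable def suppSpan : Submodule ℂ M := Submodule.span ℂ τ.suppFinite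

theorem suppSpan_le : τ.suppSpan ≤ τ.defIdeal := by
  refine Submodule.span_le.2 ?_
  rintro x ⟨hx, p, ⟨⟨hp, hpx⟩, -⟩, hτ⟩
  have hps : star p = p := hp.isSelfAdjoint.star_eq
  have hpp : p * p = p := hp.isIdempotentElem
  have hp0 : 0 ≤ p := by
    have := star_mul_self_nonneg p
    rwa [hps, hpp] at this
  have hxp : x * p = x := by
    have := congrArg star hpx
    rwa [star_mul, hps, hx.isSelfAdjoint.star_eq] at this
  have hle : x ≤ ‖x‖ • p := by
    have := CStarAlgebra.star_left_conjugate_le_norm_smul (a := p) (b := x) hx.isSelfAdjoint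
    rwa [hps, hpp, hpx, hxp] at this
  refine FinPos.mem ⟨hx, lt_of_le_of_lt (τ.mono hx hle) ?_⟩
  rw [τ.map_smul' (norm_nonneg x) hp0]
  exact ENNReal.mul_lt_top (by simp) hτ

/-- The space `suppSpan τ`, to be normed by `‖x‖₁ = τ |x|` (and not by the norm of `M`). -/
def SSpace : Type _ := ↥τ.suppSpan

namespace SSpace

variable {τ}

/-- The underlying element of the algebra. -/
noncomputable def val (x : τ.SSpace) : M := Subtype.val x

variable (τ)

noncomputable instance : AddCommGroup τ.SSpace := inferInstanceAs (AddCommGroup ↥τ.suppSpan)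

noncomputable instance : Module ℂ τ.SSpace := inferInstanceAs (Module ℂ ↥τ.suppSpan)

noncomputable instance : Norm τ.SSpace := ⟨fun x => (τ (CFC.abs x.val)).toReal⟩

variable {τ}

theorem val_mem (x : τ.SSpace) : x.val ∈ τ.defIdeal := τ.suppSpan_le (Subtype.property x)

theorem norm_def (x : τ.SSpace) : ‖x‖ = (τ (CFC.abs x.val)).toReal := rfl

theorem val_add (x y : τ.SSpace) : (x + y).val = x.val + y.val := rfl

theorem val_sub (x y : τ.SSpace) : (x - y).val = x.val - y.val := rfl

theorem val_smul (z : ℂ) (x : τ.SSpace) : (z • x).val = z • x.val := rfl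

theorem core : NormedSpace.Core ℂ τ.SSpace where
  norm_nonneg x := ENNReal.toReal_nonneg
  norm_smul c x := by
    rw [norm_def, norm_def, val_smul, CFC.abs_smul, τ.map_smul' (norm_nonneg c) (CFC.abs_nonneg _),
      ENNReal.toReal_mul, ENNReal.toReal_ofReal (norm_nonneg c)]
  norm_triangle x y := by
    rw [norm_def, norm_def, norm_def, val_add]
    exact abs_add_le x.val_mem y.val_mem
  norm_eq_zero_iff x := by
    constructor
    · intro h
      rw [norm_def, ENNReal.toReal_eq_zero_iff] at h
      have h0 : τ (CFC.abs x.val) = 0 := h.resolve_right (abs_lt_top x.val_mem).ne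
      have h1 : CFC.abs x.val = 0 := by
        by_contra hne
        exact (τ.faithful _ (CFC.abs_nonneg _) hne).ne' h0
      exact Subtype.ext (CFC.abs_eq_zero_iff.1 h1)
    · rintro rfl
      have : (0 : τ.SSpace).val = 0 := rfl
      rw [norm_def, this, CFC.abs_zero, τ.map_zero]; rfl

noncomputable instance : NormedAddCommGroup τ.SSpace := NormedAddCommGroup.ofCore core

noncomputable instance : NormedSpace ℂ τ.SSpace := NormedSpace.ofCore core

end SSpace

/-- The noncommutative `L¹` space: the completion of `(suppSpan τ, ‖·‖₁)`. -/
abbrev L1 : Type _ := UniformSpace.Completion τ.SSpace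

/-- The functional `x ↦ τ (m x)` on `suppSpan τ`. -/
noncomputable def traceMulS (m : M) : τ.SSpace →L[ℂ] ℂ :=
  LinearMap.mkContinuous
    { toFun := fun x => τ.lin (m * x.val)
      map_add' := fun x y => by
        rw [SSpace.val_add, mul_add,
          lin_add (mul_mem_defIdeal m x.val_mem) (mul_mem_defIdeal m y.val_mem)]
      map_smul' := fun z x => by
        rw [SSpace.val_smul, mul_smul_comm, lin_smul z (mul_mem_defIdeal m x.val_mem)]
        rfl }
    ‖m‖ (fun x => lin_mul_le_abs x.val_mem m)

/-- The functional `x ↦ τ (m x)` on `L1 τ`: the continuous extension of `x ↦ τ (m x)` from the dense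
subspace `suppSpan τ`. -/
noncomputable def traceMul (m : M) : τ.L1 →L[ℂ] ℂ :=
  (τ.traceMulS m).extend UniformSpace.Completion.toComplL

theorem traceMul_coe (m : M) (x : τ.SSpace) : τ.traceMul m (x : τ.L1) = τ.lin (m * x.val) :=
  ContinuousLinearMap.extend_eq (τ.traceMulS m) (e := UniformSpace.Completion.toComplL)
    UniformSpace.Completion.denseRange_coe
    (UniformSpace.Completion.isUniformInducing_coe _) x

end NSFTrace

/-! ### The circle, Poisson integrals and analytic functions -/

/-- The circle, parametrised by `t ↦ exp (2 π i t)`, see `pt`. -/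
abbrev Torus : Type := UnitAddCircle

/-- Normalised Lebesgue measure on the circle. -/
noncomputable abbrev mT : Measure Torus := AddCircle.haarAddCircle

/-- The point `exp (2 π i t)` of the unit circle in `ℂ`. -/
noncomputable def pt (t : Torus) : ℂ := (AddCircle.toCircle t : ℂ)

/-- The Poisson kernel `P_z(w) = (1 - |z|²) / |1 - conj z * w|²`. -/
noncomputable def poissonKernel (z w : ℂ) : ℝ :=
  (1 - ‖z‖ ^ 2) / ‖1 - (starRingEnd ℂ) z * w‖ ^ 2

section Generic

variable {E : Type*} [NormedAddCommGroup E] [NormedSpace ℂ E]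

/-- The Poisson integral `P[f](z) = ∫ P_z(t) f(t) dm(t)`. -/
noncomputable def poissonIntegral (f : Torus → E) (z : ℂ) : E :=
  ∫ t, poissonKernel z (pt t) • f t ∂mT

/-- `F` is analytic in the unit disc: the sum of a power series converging in the norm of `E`. -/
def AnalyticInDisc (F : ℂ → E) : Prop :=
  ∃ c : ℕ → E, ∀ z : ℂ, ‖z‖ < 1 → HasSum (fun n => z ^ n • c n) (F z)

/-- `f = ∑ l k • a k` is a decomposition of `f` with `a k ∈ A` and `∑ |l k| < ∞`. -/
structure IsAtomicDecomp (A : Set E) (f : E) (l : ℕ → ℂ) (a : ℕ → E) : Prop where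
  mem : ∀ k, a k ∈ A
  summable : Summable fun k => ‖l k‖
  hasSum : HasSum (fun k => l k • a k) f

/-- The vectors admitting an atomic decomposition with respect to `A`. -/
def atomicSpace (A : Set E) : Set E := {f | ∃ l a, IsAtomicDecomp A f l a}

/-- `inf ∑ |l k|` over all atomic decompositions of `f` with respect to `A`
(`∞` if there is none). -/
noncomputable def atomicNorm (A : Set E) (f : E) : ℝ≥0∞ :=
  ⨅ (l : ℕ → ℂ) (a : ℕ → E) (_ : IsAtomicDecomp A f l a), ∑' k, ‖l k‖ₑ

end Generic

/-! ### The scalar Hardy spaces -/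

/-- Classical `2`-atoms on the circle, supported in an arc. -/
def IsScalarAtom (b : Lp ℂ 1 mT) : Prop :=
  ∃ (c : Torus) (r : ℝ), 0 < r ∧
    (∀ᵐ t ∂mT, t ∉ Metric.ball c r → b t = 0) ∧
    ∫ t in Metric.ball c r, b t ∂mT = 0 ∧
    eLpNorm b 2 mT ≤ mT (Metric.ball c r) ^ (-(1 / 2) : ℝ)

/-- Classical `2`-atoms and constant functions of modulus less than `1`. -/
def scalarAtoms : Set (Lp ℂ 1 mT) :=
  {b | IsScalarAtom b ∨ ∃ x : ℂ, ‖x‖ < 1 ∧ ∀ᵐ t ∂mT, b t = x}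

/-- The scalar (atomic) Hardy space on the circle. -/
def scalarH1 : Set (Lp ℂ 1 mT) := atomicSpace scalarAtoms

/-- The (`2`-atomic) norm of the scalar Hardy space on the circle. -/
noncomputable def scalarH1Norm (F : Lp ℂ 1 mT) : ℝ≥0∞ := atomicNorm scalarAtoms F

/-- The norm `sup_{0 ≤ r < 1} ∫ |F (r t)| dm(t)` of the Hardy space of the disc. -/
noncomputable def discHardyNorm (F : ℂ → ℂ) : ℝ≥0∞ :=
  ⨆ r ∈ Set.Ico (0 : ℝ) 1, ∫⁻ t, ‖F ((r : ℂ) * pt t)‖ₑ ∂mT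

/-- The Hardy space of the disc. -/
def MemDiscHardy (F : ℂ → ℂ) : Prop :=
  DifferentiableOn ℂ F (Metric.ball 0 1) ∧ discHardyNorm F < ⊤

/-! ### Operator-valued Hardy spaces -/

/-- Column or row. -/
inductive Side
  | col
  | row

/-- `x* x` (column) or `x x*` (row). -/
noncomputable def Side.sq (s : Side) (x : M) : M :=
  match s with
  | Side.col => star x * x
  | Side.row => x * star x

variable (τ : NSFTrace M)

/-- For a simple function `φ = ∑ a_j χ_{F_j}` with values in the span of the positive elements with
support of finite trace: `τ ((∑ m(F_j) a_j* a_j) ^ (1/2))` in the column case,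
`τ ((∑ m(F_j) a_j a_j*) ^ (1/2))` in the row case. -/
noncomputable def simpleNorm (s : Side) (φ : SimpleFunc Torus τ.SSpace) : ℝ≥0∞ :=
  τ (CFC.sqrt (∑ y ∈ φ.range, mT.real (φ ⁻¹' {y}) • s.sq y.val))

/-- `f` is represented by a sequence of simple functions which is Cauchy for `simpleNorm τ s`, with
limit norm `r`. The completion of the simple functions for `simpleNorm τ s` embeds in
`L²(𝕋; L¹(M))`, so that the limit is taken there. -/
def IsSimpleLimit (s : Side) (f : Lp τ.L1 1 mT) (r : ℝ≥0∞) : Prop :=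
  ∃ φ : ℕ → SimpleFunc Torus τ.SSpace,
    Tendsto (fun p : ℕ × ℕ => simpleNorm τ s (φ p.1 - φ p.2)) atTop (𝓝 0) ∧
    Tendsto (fun n => eLpNorm (fun t => f t - (φ n t : τ.L1)) 2 mT) atTop (𝓝 0) ∧
    Tendsto (fun n => simpleNorm τ s (φ n)) atTop (𝓝 r)

/-- `f` belongs to the column space `L¹(M; L²_c(𝕋))`, or to the row space `L¹(M; L²_r(𝕋))`. -/
def MemL1L2 (s : Side) (f : Lp τ.L1 1 mT) : Prop := ∃ r, IsSimpleLimit τ s f r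

/-- The norm of the column (row) space (`∞` outside of it). -/
noncomputable def normL1L2 (s : Side) (f : Lp τ.L1 1 mT) : ℝ≥0∞ :=
  ⨅ (r : ℝ≥0∞) (_ : IsSimpleLimit τ s f r), r

/-- Operator-valued column (row) atoms, supported in an arc. -/
def IsAtom (s : Side) (a : Lp τ.L1 1 mT) : Prop :=
  MemL1L2 τ s a ∧ ∃ (c : Torus) (r : ℝ), 0 < r ∧
    (∀ᵐ t ∂mT, t ∉ Metric.ball c r → a t = 0) ∧
    ∫ t in Metric.ball c r, a t ∂mT = 0 ∧
    normL1L2 τ s a ≤ mT (Metric.ball c r) ^ (-(1 / 2) : ℝ)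

/-- Column (row) atoms and constant functions with value in `L¹(M)` of norm less than `1`. -/
def opAtoms (s : Side) : Set (Lp τ.L1 1 mT) :=
  {a | IsAtom τ s a ∨ ∃ x : τ.L1, ‖x‖ < 1 ∧ ∀ᵐ t ∂mT, a t = x}

/-- The norm of the atomic space `H¹_c(𝕋, M)` (or `H¹_r(𝕋, M)`). -/
noncomputable def opH1Norm (s : Side) (f : Lp τ.L1 1 mT) : ℝ≥0∞ := atomicNorm (opAtoms τ s) f

/-- The functions in the atomic space `H¹_c(𝕋, M)` (or `H¹_r(𝕋, M)`) with analytic Poisson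
integral. -/
def analyticH1 (s : Side) : Set (Lp τ.L1 1 mT) :=
  {f | f ∈ atomicSpace (opAtoms τ s) ∧ AnalyticInDisc (poissonIntegral f)}

/-- The Hardy space of operator-valued analytic functions, the sum of the column and the row
spaces. -/
def hardyCR : Set (Lp τ.L1 1 mT) :=
  {f | ∃ g ∈ analyticH1 τ Side.col, ∃ h ∈ analyticH1 τ Side.row, f = g + h}

/-- The sum norm. -/
noncomputable def hardyCRNorm (f : Lp τ.L1 1 mT) : ℝ≥0∞ :=
  ⨅ (g ∈ analyticH1 τ Side.col) (h ∈ analyticH1 τ Side.row) (_ : f = g + h),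
    opH1Norm τ Side.col g + opH1Norm τ Side.row h

/-- The scalar function `t ↦ τ (m f(t))`. -/
noncomputable def traceMulFun (m : M) (f : Lp τ.L1 1 mT) : Lp ℂ 1 mT := (τ.traceMul m).compLp f

end OpHardy

/-! Everything rests on one inequality: for a contraction `m`, the scalar function `τ (m a)` has
`L²` norm at most the column (row) norm of `a`. For a simple function with values `a i` on sets of
measure `w i`, put `N = ∑ w i |τ (m a i)|²` and test against the conjugates: with `y = ∑ w i conj (τ
(m a i)) a i` one has `τ (m y) = N`. The operator Cauchy-Schwarz inequality gives `y* y ≤ N A`,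
where `A = ∑ w i (a i)* (a i)`. The square root is operator monotone, so `N ≤ τ |y| ≤ √N τ
(A^(1/2))`, and dividing by `√N` gives the claim. The row case is the same with adjoints, since `|τ
(m y)| ≤ τ |y*|` as well. This is `sum_norm_lin_sq_le`; density extends it to the completed spaces.

Hence a contraction `m` sends operator atoms to scalar atoms on the same arc (`IsAtom.traceMulFun`),
and admissible constants to admissible constants. Atomic decompositions are therefore carried over
with unchanged coefficients; scaling `m` by its norm and adding the column and row parts gives the
first estimate.

For the disc, a bounded functional commutes with the Poisson integral, so the power series of `P[f]`
yields one for `P[τ (m f)]`. The Poisson integral contracts `L¹`, and `‖F‖₁` is at most the atomic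
norm of `F` because scalar atoms have `L¹` norm at most `1`. So the disc norm is bounded by the
atomic norm with constant `1`. -/

namespace OpHardy

/-! ### Operator Cauchy-Schwarz inequality and the trace -/

section Algebra

variable {M : Type*} [CStarAlgebra M] [PartialOrder M] [StarOrderedRing M] {τ : NSFTrace M}

/-- Operator-valued Cauchy-Schwarz inequality for finite weighted sums. -/
theorem star_mul_self_sum_smul_le {ι : Type*} (s : Finset ι) (w : ι → ℝ) (c : ι → ℂ) (a : ι → M)
    (hw : ∀ i ∈ s, 0 ≤ w i) :
    star (∑ i ∈ s, (w i * c i) • a i) * (∑ i ∈ s, (w i * c i) • a i) ≤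
      (∑ i ∈ s, w i * ‖c i‖ ^ 2) • ∑ i ∈ s, w i • (star (a i) * a i) := by
  set y := ∑ i ∈ s, (w i * c i : ℂ) • a i with hy
  set N := ∑ i ∈ s, w i * ‖c i‖ ^ 2 with hN
  have hterm : ∀ i ∈ s, 0 ≤ w i * ‖c i‖ ^ 2 := fun i hi => mul_nonneg (hw i hi) (by positivity)
  have hN0 : 0 ≤ N := Finset.sum_nonneg hterm
  -- The argument ends with a division by `N`. If `N = 0`, each `w i * c i` vanishes, and so does
  -- `y`.
  rcases hN0.eq_or_lt with h0 | hpos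
  · have hz : ∀ i ∈ s, (w i * c i : ℂ) • a i = 0 := by
      intro i hi
      have h1 := (Finset.sum_eq_zero_iff_of_nonneg hterm).1 h0.symm i hi
      rcases mul_eq_zero.1 h1 with h | h
      · simp [h]
      · have : c i = 0 := by simpa using h
        simp [this]
    have : y = 0 := Finset.sum_eq_zero hz
    rw [this, ← h0]
    simp
  have hsy : star y = ∑ i ∈ s, (w i * star (c i) : ℂ) • star (a i) := by
    simp [hy, star_sum, star_smul]
  -- Completing the square: after summation the two cross terms contribute `-2 N y* y` and the last
  -- term `+N y* y`, which leaves `N (N ∑ w i (a i)* (a i) - y* y)`.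
  have key : 0 ≤ ∑ i ∈ s, w i • (star ((N : ℂ) • a i - star (c i) • y) *
      ((N : ℂ) • a i - star (c i) • y)) :=
    Finset.sum_nonneg fun i hi => smul_nonneg (hw i hi) (star_mul_self_nonneg _)
  have e : ∑ i ∈ s, w i • (star ((N : ℂ) • a i - star (c i) • y) *
      ((N : ℂ) • a i - star (c i) • y)) =
      N • (N • (∑ i ∈ s, w i • (star (a i) * a i)) - star y * y) := by
    have e1 : ∀ i ∈ s, w i • (star ((N : ℂ) • a i - star (c i) • y) *
        ((N : ℂ) • a i - star (c i) • y)) = (N : ℂ) • (N : ℂ) • (w i • (star (a i) * a i))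
          - (N : ℂ) • (((w i * star (c i) : ℂ) • star (a i)) * y)
          - (N : ℂ) • (star y * ((w i * c i : ℂ) • a i))
          + ((w i * ‖c i‖ ^ 2 : ℝ) : ℂ) • (star y * y) := by
      intro i _
      have hc : (‖c i‖ : ℂ) ^ 2 = c i * star (c i) := by
        rw [Complex.star_def, Complex.mul_conj, Complex.normSq_eq_norm_sq]; push_cast; rfl
      simp only [star_sub, star_smul, Complex.star_def, Complex.conj_ofReal, Complex.conj_conj,
        sub_mul, mul_sub, smul_mul_assoc, mul_smul_comm]
      push_cast
      rw [hc, Complex.star_def]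
      simp only [← Complex.coe_smul (w i)]
      module
    rw [Finset.sum_congr rfl e1]
    simp only [Finset.sum_add_distrib, Finset.sum_sub_distrib, ← Finset.smul_sum,
      ← Finset.sum_mul, ← Finset.mul_sum, ← Finset.sum_smul, ← hsy, ← hy]
    rw [← Complex.ofReal_sum, ← hN]
    simp only [← Complex.coe_smul N]
    module
  rw [e] at key
  have h2 := smul_nonneg (inv_nonneg.2 hN0) key
  rw [smul_smul, inv_mul_cancel₀ hpos.ne', one_smul] at h2
  exact sub_nonneg.1 h2

theorem Side.sq_nonneg (s : Side) (x : M) : 0 ≤ s.sq x := by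
  cases s
  · exact star_mul_self_nonneg x
  · exact mul_star_self_nonneg x

theorem Side.sq_sum_smul_le (σ : Side) {ι : Type*} (s : Finset ι) (w : ι → ℝ) (c : ι → ℂ)
    (a : ι → M) (hw : ∀ i ∈ s, 0 ≤ w i) :
    σ.sq (∑ i ∈ s, (w i * c i) • a i) ≤
      (∑ i ∈ s, w i * ‖c i‖ ^ 2) • ∑ i ∈ s, w i • σ.sq (a i) := by
  cases σ
  · exact star_mul_self_sum_smul_le s w c a hw
  -- The row case is the column case for the adjoints with conjugated coefficients; the weights are
  -- real.
  · have h := star_mul_self_sum_smul_le s w (fun i => star (c i)) (fun i => star (a i)) hw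
    have e : star (∑ i ∈ s, (w i * c i : ℂ) • a i) =
        ∑ i ∈ s, (w i * star (c i) : ℂ) • star (a i) := by
      simp [star_sum, star_smul]
    rw [← e, star_star] at h
    simpa [Side.sq] using h

theorem CFC_sqrt_real_smul {r : ℝ} (hr : 0 ≤ r) {x : M} (hx : 0 ≤ x) :
    CFC.sqrt ((r * r) • x) = r • CFC.sqrt x := by
  refine CFC.sqrt_unique ?_ (smul_nonneg hr (CFC.sqrt_nonneg x))
  rw [smul_mul_smul_comm, CFC.sqrt_mul_sqrt_self x hx]

namespace NSFTrace

/-- A bound for `x ↦ τ (m x)` in terms of `|x*|`. -/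
theorem lin_mul_le_abs_star {x : M} (hx : x ∈ τ.defIdeal) {m : M} (hm : ‖m‖ ≤ 1) :
    ‖τ.lin (m * x)‖ ≤ (τ (CFC.abs (star x))).toReal := by
  -- From `x* = w b` comes `x = b* w*`, and traciality gives `τ (b b*) = τ (w w*) = τ |x*|`, the two
  -- quantities in the bound for a product.
  obtain ⟨w, b, e1, e2, e3⟩ := exists_factor (star x)
  have ht := abs_lt_top (star_mem_defIdeal hx)
  have hw : τ (star (star b) * star b) = τ (CFC.abs (star x)) := by
    rw [star_star, ← τ.tracial, e3]
  have hb : τ (star (star w) * star w) = τ (CFC.abs (star x)) := by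
    rw [star_star, ← τ.tracial, e2]
  have h := (lin_mul_mul_le (τ := τ) m (by rwa [hw]) (by rwa [hb])).2 hm
  have e : star b * star w = x := by rw [← star_mul, e1, star_star]
  rwa [hw, hb, add_self_div_two, mul_assoc, e] at h

/-- Puts both sides on the same footing: `(x* x)^(1/2) = |x|` and `(x x*)^(1/2) = |x*|`, and each of
these controls the functional. -/
theorem enorm_lin_mul_le_sqrt_sq (s : Side) {x : M} (hx : x ∈ τ.defIdeal) {m : M} (hm : ‖m‖ ≤ 1) :
    ‖τ.lin (m * x)‖ₑ ≤ τ (CFC.sqrt (s.sq x)) := by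
  rw [← ofReal_norm]
  cases s
  · refine ENNReal.ofReal_le_of_le_toReal ((lin_mul_le_abs hx m).trans ?_)
    exact mul_le_of_le_one_left ENNReal.toReal_nonneg hm
  · refine ENNReal.ofReal_le_of_le_toReal ((lin_mul_le_abs_star hx hm).trans_eq ?_)
    rw [CFC.abs, star_star]; rfl

/-- `(∑ w i |τ (m a i)|²)^(1/2) ≤ τ ((∑ w i |a i|²)^(1/2))` for contractions `m`. -/
theorem sum_norm_lin_sq_le (s : Side) {ι : Type*} (t : Finset ι) (w : ι → ℝ) (a : ι → M)
    (hw : ∀ i ∈ t, 0 ≤ w i) (ha : ∀ i, a i ∈ τ.defIdeal) {m : M} (hm : ‖m‖ ≤ 1) :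
    ENNReal.ofReal (√(∑ i ∈ t, w i * ‖τ.lin (m * a i)‖ ^ 2)) ≤
      τ (CFC.sqrt (∑ i ∈ t, w i • s.sq (a i))) := by
  -- These coefficients are the extremal ones in `ℓ²` duality: they make `τ (m y)` equal to `N`.
  set c : ι → ℂ := fun i => star (τ.lin (m * a i)) with hc
  set N := ∑ i ∈ t, w i * ‖τ.lin (m * a i)‖ ^ 2 with hN
  have hcN : ∑ i ∈ t, w i * ‖c i‖ ^ 2 = N := by simp [hc, hN]
  have hN0 : 0 ≤ N := Finset.sum_nonneg fun i hi => mul_nonneg (hw i hi) (by positivity)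
  rcases hN0.eq_or_lt with h0 | hpos
  · simp [← h0]
  set A := ∑ i ∈ t, w i • s.sq (a i) with hA
  have hA0 : 0 ≤ A := Finset.sum_nonneg fun i hi => smul_nonneg (hw i hi) (s.sq_nonneg _)
  set y := ∑ i ∈ t, (w i * c i : ℂ) • a i with hy
  have hyD : ∀ u : Finset ι, ∑ i ∈ u, (w i * c i : ℂ) • a i ∈ τ.defIdeal := fun u =>
    Submodule.sum_mem _ fun i _ => Submodule.smul_mem _ _ (ha i)
  have hlin : τ.lin (m * y) = (N : ℂ) := by
    have : ∀ u : Finset ι, τ.lin (m * ∑ i ∈ u, (w i * c i : ℂ) • a i) =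
        ∑ i ∈ u, (w i * c i : ℂ) * τ.lin (m * a i) := by
      classical
      intro u
      induction u using Finset.induction_on with
      | empty =>
        have := lin_smul (τ := τ) 0 (Submodule.zero_mem _)
        simpa using this
      | insert i u hi ih =>
        rw [Finset.sum_insert hi, Finset.sum_insert hi, mul_add, mul_smul_comm,
          lin_add (Submodule.smul_mem _ _ (mul_mem_defIdeal m (ha i)))
            (mul_mem_defIdeal m (hyD u)), lin_smul _ (mul_mem_defIdeal m (ha i)), ih]
    rw [hy, this, hN]
    push_cast
    refine Finset.sum_congr rfl fun i _ => ?_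
    rw [mul_assoc, hc, Complex.star_def, Complex.conj_mul']
  have h1 := enorm_lin_mul_le_sqrt_sq s (hyD t) hm
  rw [← hy, hlin] at h1
  -- The square root, unlike the square, is operator monotone, so the inequality between squares
  -- passes to moduli.
  have h2 : CFC.sqrt (s.sq y) ≤ √N • CFC.sqrt A := by
    rw [← CFC_sqrt_real_smul (Real.sqrt_nonneg N) hA0, Real.mul_self_sqrt hN0, ← hcN]
    exact CFC.sqrt_le_sqrt _ _ (s.sq_sum_smul_le t w c a hw)
  have h3 := h1.trans (τ.mono (CFC.sqrt_nonneg _) h2)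
  rw [τ.map_smul' (Real.sqrt_nonneg N) (CFC.sqrt_nonneg A), ← ofReal_norm,
    Complex.norm_real, Real.norm_of_nonneg hN0] at h3
  -- The estimate becomes `√N √N ≤ √N τ (A^(1/2))`. The factor `√N` is nonzero and finite, so it
  -- cancels in `[0, ∞]` whether or not the trace is finite.
  nth_rewrite 1 [← Real.mul_self_sqrt hN0] at h3
  rw [ENNReal.ofReal_mul (Real.sqrt_nonneg N)] at h3
  have h4 : ENNReal.ofReal √N ≠ 0 := by
    simpa using hpos
  exact (ENNReal.mul_le_mul_iff_right h4 ENNReal.ofReal_ne_top).1 h3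

end NSFTrace

end Algebra

/-! ### Calculus of atomic decompositions -/

section Atomic

variable {E F : Type*} [NormedAddCommGroup E] [NormedSpace ℂ E] [NormedAddCommGroup F]
  [NormedSpace ℂ F]

theorem IsAtomicDecomp.mem_atomicSpace {A : Set E} {f : E} {l : ℕ → ℂ} {a : ℕ → E}
    (h : IsAtomicDecomp A f l a) : f ∈ atomicSpace A := ⟨l, a, h⟩

theorem IsAtomicDecomp.atomicNorm_le {A : Set E} {f : E} {l : ℕ → ℂ} {a : ℕ → E}
    (h : IsAtomicDecomp A f l a) : atomicNorm A f ≤ ∑' k, ‖l k‖ₑ :=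
  iInf_le_of_le l (iInf_le_of_le a (iInf_le_of_le h le_rfl))

theorem IsAtomicDecomp.map {A : Set E} {B : Set F} {f : E} {l : ℕ → ℂ} {a : ℕ → E}
    (h : IsAtomicDecomp A f l a) (T : E →L[ℂ] F) (hT : ∀ x ∈ A, T x ∈ B) :
    IsAtomicDecomp B (T f) l (fun k => T (a k)) where
  mem k := hT _ (h.mem k)
  summable := h.summable
  hasSum := by simpa using T.hasSum h.hasSum

theorem IsAtomicDecomp.smul {A : Set E} {f : E} {l : ℕ → ℂ} {a : ℕ → E}
    (h : IsAtomicDecomp A f l a) (c : ℂ) : IsAtomicDecomp A (c • f) (fun k => c * l k) a where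
  mem := h.mem
  summable := by simpa using h.summable.mul_left ‖c‖
  hasSum := by simpa [mul_smul] using h.hasSum.const_smul c

/-- The two decompositions are indexed jointly by `ℕ ⊕ ℕ` and relabelled by `ℕ`. The exact value of
the coefficient sum is kept, since subadditivity of the norm rests on it. -/
theorem IsAtomicDecomp.add {A : Set E} {f g : E} {l l' : ℕ → ℂ} {a a' : ℕ → E}
    (h : IsAtomicDecomp A f l a) (h' : IsAtomicDecomp A g l' a') :
    ∃ l'' a'', IsAtomicDecomp A (f + g) l'' a'' ∧
      ∑' k, ‖l'' k‖ₑ = (∑' k, ‖l k‖ₑ) + ∑' k, ‖l' k‖ₑ := by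
  let e := Equiv.natSumNatEquivNat.symm
  have h1 : Summable fun x : ℕ ⊕ ℕ => ‖Sum.elim l l' x‖ :=
    (HasSum.sum (f := fun x : ℕ ⊕ ℕ => ‖Sum.elim l l' x‖) h.summable.hasSum
      h'.summable.hasSum).summable
  have h2 : HasSum (fun x : ℕ ⊕ ℕ => Sum.elim l l' x • Sum.elim a a' x) (f + g) :=
    HasSum.sum h.hasSum h'.hasSum
  refine ⟨fun k => Sum.elim l l' (e k), fun k => Sum.elim a a' (e k), ⟨fun k => ?_, ?_, ?_⟩, ?_⟩
  · rcases e k with i | i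
    · exact h.mem i
    · exact h'.mem i
  · exact (e.summable_iff (f := fun x : ℕ ⊕ ℕ => ‖Sum.elim l l' x‖)).2 h1
  · exact (e.hasSum_iff (f := fun x : ℕ ⊕ ℕ => Sum.elim l l' x • Sum.elim a a' x)).2 h2
  · rw [e.tsum_eq (fun x : ℕ ⊕ ℕ => ‖Sum.elim l l' x‖ₑ)]
    exact ENNReal.summable.tsum_sum ENNReal.summable

theorem atomicNorm_add_le (A : Set E) (f g : E) :
    atomicNorm A (f + g) ≤ atomicNorm A f + atomicNorm A g := by
  simp only [atomicNorm.eq_1 A f, atomicNorm.eq_1 A g, ENNReal.iInf_add, ENNReal.add_iInf]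
  refine le_iInf fun l' => le_iInf fun a' => le_iInf fun h' => le_iInf fun l => le_iInf fun a =>
    le_iInf fun h => ?_
  obtain ⟨l'', a'', h'', e⟩ := h.add h'
  exact h''.atomicNorm_le.trans e.le

theorem add_mem_atomicSpace {A : Set E} {f g : E} (hf : f ∈ atomicSpace A)
    (hg : g ∈ atomicSpace A) : f + g ∈ atomicSpace A := by
  obtain ⟨l, a, h⟩ := hf
  obtain ⟨l', a', h'⟩ := hg
  obtain ⟨l'', a'', h'', -⟩ := h.add h'
  exact h''.mem_atomicSpace

theorem map_mem_atomicSpace {A : Set E} {B : Set F} {f : E} (T : E →L[ℂ] F) (hT : ∀ x ∈ A, T x ∈ B)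
    (hf : f ∈ atomicSpace A) : T f ∈ atomicSpace B := by
  obtain ⟨l, a, h⟩ := hf
  exact (h.map T hT).mem_atomicSpace

theorem atomicNorm_map_le {A : Set E} {B : Set F} (T : E →L[ℂ] F) (hT : ∀ x ∈ A, T x ∈ B) (f : E) :
    atomicNorm B (T f) ≤ atomicNorm A f :=
  le_iInf fun _ => le_iInf fun _ => le_iInf fun h => (h.map T hT).atomicNorm_le

theorem smul_mem_atomicSpace {A : Set E} {f : E} (hf : f ∈ atomicSpace A) (c : ℂ) :
    c • f ∈ atomicSpace A := by
  obtain ⟨l, a, h⟩ := hf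
  exact (h.smul c).mem_atomicSpace

/-- Membership of `f` matters at `c = 0`: without a decomposition the right side would be `0 * ∞ =
0`, while the left side could be infinite (for `A` empty). -/
theorem atomicNorm_smul_le {A : Set E} {f : E} (hf : f ∈ atomicSpace A) (c : ℂ) :
    atomicNorm A (c • f) ≤ ‖c‖ₑ * atomicNorm A f := by
  have key : ∀ l a, IsAtomicDecomp A f l a → atomicNorm A (c • f) ≤ ‖c‖ₑ * ∑' k, ‖l k‖ₑ := by
    intro l a h
    refine (h.smul c).atomicNorm_le.trans_eq ?_
    simp only [enorm_mul, ENNReal.tsum_mul_left]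
  by_cases hc : c = 0
  · obtain ⟨l, a, h⟩ := hf
    simpa [hc] using key l a h
  · have hc' : ‖c‖ₑ ≠ 0 := by simpa using hc
    simp only [atomicNorm.eq_1 A f, ENNReal.mul_iInf_of_ne hc' enorm_ne_top]
    exact le_iInf fun l => le_iInf fun a => le_iInf fun h => key l a h

theorem enorm_le_atomicNorm {A : Set E} (hA : ∀ x ∈ A, ‖x‖ₑ ≤ 1) (f : E) :
    ‖f‖ₑ ≤ atomicNorm A f := by
  refine le_iInf fun l => le_iInf fun a => le_iInf fun h => ?_
  rw [← h.hasSum.tsum_eq]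
  refine (enorm_tsum_le_tsum_enorm).trans (ENNReal.tsum_le_tsum fun k => ?_)
  rw [enorm_smul]
  exact mul_le_of_le_one_right' (hA _ (h.mem k))

end Atomic

/-! ### Power series, Poisson integrals and scalar atoms -/

section Disc

/-- A power series converging in the disc is differentiable there. -/
theorem AnalyticInDisc.differentiableOn {F : ℂ → ℂ} (h : AnalyticInDisc F) :
    DifferentiableOn ℂ F (Metric.ball 0 1) := by
  obtain ⟨c, hc⟩ := h
  intro z hz
  have hz1 : ‖z‖ < 1 := by simpa using hz
  obtain ⟨r, hzr, hr⟩ := exists_between hz1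
  have hr0 : 0 ≤ r := (norm_nonneg z).trans hzr.le
  -- Summability in `ℂ` is absolute, so the series at the radius `r` is a majorant on the whole ball
  -- of radius `r`, and the Weierstrass theorem applies.
  have hs : Summable fun n => ‖(r : ℂ) ^ n • c n‖ :=
    (hc r (by rwa [Complex.norm_real, Real.norm_of_nonneg hr0])).summable.norm
  have hd : DifferentiableOn ℂ (fun w : ℂ => ∑' n, w ^ n • c n) (Metric.ball (0 : ℂ) r) := by
    refine Complex.differentiableOn_tsum_of_summable_norm hs (fun n => by fun_prop) Metric.isOpen_ball
      fun n w hw => ?_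
    rw [norm_smul, norm_smul, norm_pow, norm_pow, Complex.norm_real, Real.norm_of_nonneg hr0]
    have : ‖w‖ ≤ r := by simpa using (Metric.mem_ball.1 hw).le
    gcongr
  have hzU : Metric.ball (0 : ℂ) r ∈ 𝓝 z := Metric.isOpen_ball.mem_nhds (by simpa using hzr)
  refine ((hd.differentiableAt hzU).congr_of_eventuallyEq ?_).differentiableWithinAt
  filter_upwards [hzU] with w hw
  exact (hc w ((by simpa using hw : ‖w‖ < r).trans hr)).tsum_eq.symm

theorem continuous_pt : Continuous pt := by unfold pt; fun_prop

theorem norm_pt (t : Torus) : ‖pt t‖ = 1 := Circle.norm_coe _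

theorem pt_sub (s t : Torus) : pt (s - t) = pt s * starRingEnd ℂ (pt t) := by
  unfold pt
  rw [sub_eq_add_neg, AddCircle.toCircle_add, AddCircle.toCircle_neg, Circle.coe_mul,
    Circle.coe_inv_eq_conj]

theorem one_sub_ne_zero_of_norm_lt {z : ℂ} (hz : ‖z‖ < 1) : 1 - z ≠ 0 := by
  intro h
  rw [← sub_eq_zero.1 h] at hz
  simp at hz

theorem norm_conj_mul_pt_lt {z : ℂ} (hz : ‖z‖ < 1) (t : Torus) :
    ‖starRingEnd ℂ z * pt t‖ < 1 := by
  rw [norm_mul, norm_pt, mul_one, RCLike.norm_conj]; exact hz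

theorem continuous_poissonKernel_pt {z : ℂ} (hz : ‖z‖ < 1) :
    Continuous fun t => poissonKernel z (pt t) := by
  unfold poissonKernel
  refine Continuous.div (by fun_prop) (by have := continuous_pt; fun_prop) fun t => ?_
  have := one_sub_ne_zero_of_norm_lt (norm_conj_mul_pt_lt hz t)
  positivity

theorem poissonKernel_nonneg {z : ℂ} (hz : ‖z‖ < 1) (w : ℂ) : 0 ≤ poissonKernel z w := by
  unfold poissonKernel
  have : ‖z‖ ^ 2 ≤ 1 := pow_le_one₀ (norm_nonneg _) hz.le
  exact div_nonneg (by linarith) (by positivity)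

variable {E : Type*} [NormedAddCommGroup E] [NormedSpace ℂ E]

theorem integrable_poissonKernel_smul {z : ℂ} (hz : ‖z‖ < 1) {f : Torus → E}
    (hf : Integrable f mT) : Integrable (fun t => poissonKernel z (pt t) • f t) mT := by
  have hc := continuous_poissonKernel_pt hz
  obtain ⟨C, hC⟩ := isCompact_univ.exists_bound_of_continuousOn hc.continuousOn
  exact Integrable.bdd_smul (𝕜 := ℝ) hf C hc.aestronglyMeasurable
    (ae_of_all _ fun t => hC t (Set.mem_univ t))

/-- The powers of `pt` are the Fourier characters, and the integral is the zeroth Fourier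
coefficient. -/
theorem integral_pt_pow (n : ℕ) : ∫ t, pt t ^ n ∂mT = if n = 0 then 1 else 0 := by
  have h := congrFun (fourierCoeff_fourier (T := (1 : ℝ)) (n : ℤ)) 0
  have e : ∀ t : Torus, pt t ^ n = fourier (n : ℤ) t := by
    intro t
    simp [pt, fourier_apply, AddCircle.toCircle_nsmul]
  simp only [e]
  rw [fourierCoeff] at h
  simpa [Pi.single_apply, eq_comm] using h

/-- Exhibits the kernel as the real part of a geometric series, which can be integrated term by
term. Real `r` suffices, because rotations reduce every point of the disc to its radius. -/
theorem poissonKernel_eq_re {r : ℝ} (hr0 : 0 ≤ r) (hr : r < 1) {w : ℂ} (hw : ‖w‖ = 1) :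
    poissonKernel r w = (2 * (1 - r * w)⁻¹ - 1).re := by
  have hrw : ‖(r : ℂ) * w‖ < 1 := by simpa [hw, abs_of_nonneg hr0] using hr
  have hne := one_sub_ne_zero_of_norm_lt hrw
  have hw2 : w.re ^ 2 + w.im ^ 2 = 1 := by
    have := Complex.normSq_eq_norm_sq w
    rw [hw, Complex.normSq_apply] at this; linarith
  have hn : Complex.normSq (1 - r * w) ≠ 0 := by simpa using hne
  unfold poissonKernel
  rw [← Complex.normSq_eq_norm_sq, ← Complex.normSq_eq_norm_sq, Complex.conj_ofReal,
    Complex.sub_re, Complex.mul_re, Complex.inv_re]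
  simp only [Complex.re_ofNat, Complex.im_ofNat, Complex.one_re, zero_mul, sub_zero,
    Complex.normSq_ofReal]
  field_simp
  simp [Complex.normSq_apply]
  linear_combination (r ^ 2) * hw2

/-- Only the constant term of the geometric series has a nonzero integral, so `(1 - r w)⁻¹`
integrates to `1` and the kernel to `2 * 1 - 1`. -/
theorem integral_poissonKernel {r : ℝ} (hr0 : 0 ≤ r) (hr : r < 1) :
    ∫ t, poissonKernel r (pt t) ∂mT = 1 := by
  have hrw : ∀ t, ‖(r : ℂ) * pt t‖ = r := fun t => by simp [norm_pt, abs_of_nonneg hr0]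
  have hcp := continuous_pt
  have hint : ∀ n : ℕ, Integrable (fun t => ((r : ℂ) * pt t) ^ n) mT := fun n =>
    Continuous.integrable_of_hasCompactSupport (by fun_prop)
      (HasCompactSupport.of_compactSpace _)
  have h1 : HasSum (fun n : ℕ => ∫ t, ((r : ℂ) * pt t) ^ n ∂mT)
      (∫ t, ∑' n : ℕ, ((r : ℂ) * pt t) ^ n ∂mT) := by
    refine hasSum_integral_of_summable_integral_norm hint ?_
    simp only [norm_pow, hrw]
    simpa using summable_geometric_of_lt_one hr0 hr
  have h2 : ∀ n : ℕ, ∫ t, ((r : ℂ) * pt t) ^ n ∂mT = if n = 0 then 1 else 0 := by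
    intro n
    simp only [mul_pow]
    rw [integral_const_mul, integral_pt_pow]
    split_ifs with h <;> simp [h]
  simp only [h2] at h1
  have h3 := h1.unique (hasSum_ite_eq 0 (1 : ℂ))
  have h4 : ∀ t, ∑' n : ℕ, ((r : ℂ) * pt t) ^ n = (1 - r * pt t)⁻¹ := fun t =>
    tsum_geometric_of_norm_lt_one (by rw [hrw]; exact hr)
  simp only [h4] at h3
  have hne : ∀ t, 1 - (r : ℂ) * pt t ≠ 0 := fun t =>
    one_sub_ne_zero_of_norm_lt (by rw [hrw]; exact hr)
  have hi : Integrable (fun t => (1 - (r : ℂ) * pt t)⁻¹) mT :=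
    Continuous.integrable_of_hasCompactSupport (Continuous.inv₀ (by fun_prop) hne)
      (HasCompactSupport.of_compactSpace _)
  simp only [poissonKernel_eq_re hr0 hr (norm_pt _)]
  have := integral_re (𝕜 := ℂ) ((hi.const_mul 2).sub (integrable_const (1 : ℂ)))
  simp only [Pi.sub_apply, RCLike.re_eq_complex_re] at this
  rw [this, integral_sub (hi.const_mul 2) (integrable_const _), integral_const_mul, h3]
  norm_num

/-- Turns the Poisson integral on a circle into a convolution, the form in which Tonelli and
invariance of the measure apply. -/
theorem poissonKernel_rotate {r : ℝ} (s t : Torus) :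
    poissonKernel (r * pt t) (pt s) = poissonKernel r (pt (s - t)) := by
  unfold poissonKernel
  rw [pt_sub, map_mul, Complex.conj_ofReal, norm_mul, norm_pt, mul_one]
  ring_nf

/-- The Poisson integral is a contraction on `L¹`. -/
theorem lintegral_enorm_poissonIntegral_le {r : ℝ} (hr0 : 0 ≤ r) (hr : r < 1) {f : Torus → E}
    (hf : AEStronglyMeasurable f mT) :
    ∫⁻ t, ‖poissonIntegral f (r * pt t)‖ₑ ∂mT ≤ eLpNorm f 1 mT := by
  have hrn : ‖(r : ℂ)‖ < 1 := by rwa [Complex.norm_real, Real.norm_of_nonneg hr0]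
  have hK := continuous_poissonKernel_pt hrn
  calc ∫⁻ t, ‖poissonIntegral f (r * pt t)‖ₑ ∂mT
      ≤ ∫⁻ t, ∫⁻ s, ENNReal.ofReal (poissonKernel r (pt (s - t))) * ‖f s‖ₑ ∂mT ∂mT := by
        refine lintegral_mono fun t => (enorm_integral_le_lintegral_enorm _).trans_eq ?_
        refine lintegral_congr fun s => ?_
        rw [enorm_smul, poissonKernel_rotate, Real.enorm_of_nonneg (poissonKernel_nonneg hrn _)]
    _ = ∫⁻ s, ∫⁻ t, ENNReal.ofReal (poissonKernel r (pt (s - t))) * ‖f s‖ₑ ∂mT ∂mT := by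
        refine lintegral_lintegral_swap ?_
        exact (ENNReal.continuous_ofReal.comp
          (hK.comp (continuous_snd.sub continuous_fst))).aemeasurable.mul hf.enorm.comp_snd
    _ = ∫⁻ s, ‖f s‖ₑ ∂mT := by
        refine lintegral_congr fun s => ?_
        have hm : Measurable fun t => ENNReal.ofReal (poissonKernel r (pt (s - t))) :=
          (ENNReal.continuous_ofReal.comp (hK.comp (continuous_const.sub continuous_id))).measurable
        -- The substitution `t ↦ s - t` preserves Haar measure, so the inner integral is the total
        -- mass of the kernel for every `s`.
        rw [lintegral_mul_const _ hm,
          lintegral_sub_left_eq_self (fun u => ENNReal.ofReal (poissonKernel r (pt u))) s,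
          ← ofReal_integral_eq_lintegral_ofReal, integral_poissonKernel hr0 hr]
        · simp
        · exact hK.integrable_of_hasCompactSupport (HasCompactSupport.of_compactSpace _)
        · exact ae_of_all _ fun t => poissonKernel_nonneg hrn _
    _ = eLpNorm f 1 mT := eLpNorm_one_eq_lintegral_enorm.symm

theorem discHardyNorm_poissonIntegral_le (F : Lp ℂ 1 mT) :
    discHardyNorm (poissonIntegral F) ≤ ‖F‖ₑ := by
  refine iSup₂_le fun r hr => ?_
  refine (lintegral_enorm_poissonIntegral_le hr.1 hr.2 (Lp.aestronglyMeasurable F)).trans_eq ?_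
  rw [Lp.enorm_def]

theorem measure_ball_pos (c : Torus) {r : ℝ} (hr : 0 < r) : 0 < mT (Metric.ball c r) :=
  Metric.measure_ball_pos _ _ hr

/-- Cauchy-Schwarz on the arc `I`: `‖b‖₁ ≤ |I|^(1/2) ‖b‖₂ ≤ |I|^(1/2) |I|^(-1/2) = 1`. -/
theorem IsScalarAtom.enorm_le_one {b : Lp ℂ 1 mT} (hb : IsScalarAtom b) : ‖b‖ₑ ≤ 1 := by
  obtain ⟨c, r, hr, hsupp, -, hnorm⟩ := hb
  have hI : MeasurableSet (Metric.ball c r) := measurableSet_ball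
  -- Restricting to the arc first is what produces the factor `|I|^(1/2)` instead of `1`.
  have e : eLpNorm b 1 mT = eLpNorm b 1 (mT.restrict (Metric.ball c r)) := by
    rw [← eLpNorm_indicator_eq_eLpNorm_restrict hI]
    refine eLpNorm_congr_ae ?_
    filter_upwards [hsupp] with t ht
    by_cases h : t ∈ Metric.ball c r
    · simp [h]
    · simp [h, ht h]
  have hpos := (measure_ball_pos c hr).ne'
  have hfin : mT (Metric.ball c r) ≠ ⊤ := measure_ne_top _ _
  rw [Lp.enorm_def, e]
  refine (eLpNorm_le_eLpNorm_mul_rpow_measure_univ one_le_two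
    (Lp.aestronglyMeasurable b).restrict).trans ?_
  refine (mul_le_mul' ((eLpNorm_mono_measure _ Measure.restrict_le_self).trans hnorm)
    le_rfl).trans_eq ?_
  rw [Measure.restrict_apply_univ, ← ENNReal.rpow_add _ _ hpos hfin]
  norm_num

theorem enorm_le_one_of_mem_scalarAtoms {b : Lp ℂ 1 mT} (hb : b ∈ scalarAtoms) : ‖b‖ₑ ≤ 1 := by
  rcases hb with hb | ⟨x, hx, hb⟩
  · exact hb.enorm_le_one
  · rw [Lp.enorm_def, eLpNorm_congr_ae hb, eLpNorm_const _ one_ne_zero (NeZero.ne _)]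
    simp only [measure_univ, ENNReal.one_rpow, mul_one]
    rw [← ofReal_norm]
    exact ENNReal.ofReal_le_one.2 hx.le

end Disc

/-! ### From operator-valued to scalar Hardy spaces -/

section Main

variable {M : Type*} [CStarAlgebra M] [PartialOrder M] [StarOrderedRing M] {τ : NSFTrace M}

/-- The sum runs over the values of `φ`, not of `g ∘ φ`, so that it can be compared term by term
with the sum in `simpleNorm`. -/
theorem eLpNorm_two_simpleFunc {E F : Type*} [NormedAddCommGroup F] (φ : SimpleFunc Torus E)
    (g : E → F) : eLpNorm (fun t => g (φ t)) 2 mT =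
      ENNReal.ofReal (√(∑ y ∈ φ.range, mT.real (φ ⁻¹' {y}) * ‖g y‖ ^ 2)) := by
  have h : ∫⁻ t, ‖g (φ t)‖ₑ ^ (2 : ℝ) ∂mT =
      ENNReal.ofReal (∑ y ∈ φ.range, mT.real (φ ⁻¹' {y}) * ‖g y‖ ^ 2) := by
    have e : ∀ t, ‖g (φ t)‖ₑ ^ (2 : ℝ) = φ.map (fun y => ‖g y‖ₑ ^ (2 : ℝ)) t := fun t => rfl
    simp only [e]
    rw [SimpleFunc.lintegral_eq_lintegral, SimpleFunc.map_lintegral,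
      ENNReal.ofReal_sum_of_nonneg fun y _ => by positivity]
    refine Finset.sum_congr rfl fun y _ => ?_
    rw [ENNReal.ofReal_mul measureReal_nonneg, ofReal_measureReal, mul_comm,
      ENNReal.ofReal_pow (norm_nonneg _), ofReal_norm]
    norm_num
  rw [eLpNorm_eq_lintegral_rpow_enorm_toReal two_ne_zero ENNReal.ofNat_ne_top]
  simp only [ENNReal.toReal_ofNat]
  rw [h, ENNReal.ofReal_rpow_of_nonneg (Finset.sum_nonneg fun y _ => by positivity) (by norm_num),
    Real.sqrt_eq_rpow]

theorem eLpNorm_traceMulS_le (s : Side) (φ : SimpleFunc Torus τ.SSpace) {m : M} (hm : ‖m‖ ≤ 1) :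
    eLpNorm (fun t => τ.traceMulS m (φ t)) 2 mT ≤ simpleNorm τ s φ := by
  rw [eLpNorm_two_simpleFunc φ (τ.traceMulS m)]
  exact NSFTrace.sum_norm_lin_sq_le s φ.range (fun y => mT.real (φ ⁻¹' {y}))
    NSFTrace.SSpace.val (fun _ _ => measureReal_nonneg) NSFTrace.SSpace.val_mem hm

theorem traceMul_coe_eq (m : M) (x : τ.SSpace) : τ.traceMul m (x : τ.L1) = τ.traceMulS m x :=
  τ.traceMul_coe m x

theorem eLpNorm_clm_comp_le {E F : Type*} [NormedAddCommGroup E] [NormedSpace ℂ E]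
    [NormedAddCommGroup F] [NormedSpace ℂ F] (T : E →L[ℂ] F) (f : Torus → E) (p : ℝ≥0∞) :
    eLpNorm (fun t => T (f t)) p mT ≤ ‖T‖ₑ * eLpNorm f p mT :=
  eLpNorm_le_nnreal_smul_eLpNorm_of_ae_le_mul (c := ‖T‖₊) (ae_of_all _ fun _ => T.le_opNNNorm _) p

/-- Splitting `f = (f - φ n) + φ n`, the first part is small in `L²` by boundedness of the
functional, and the second is bounded by the simple-function inequality, whose right side tends to
`r`. -/
theorem IsSimpleLimit.eLpNorm_traceMulFun_le {s : Side} {f : Lp τ.L1 1 mT} {r : ℝ≥0∞}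
    (h : IsSimpleLimit τ s f r) {m : M} (hm : ‖m‖ ≤ 1) :
    eLpNorm (traceMulFun τ m f) 2 mT ≤ r := by
  obtain ⟨φ, -, h1, h2⟩ := h
  have hφ : ∀ n, AEStronglyMeasurable (fun t => (φ n t : τ.L1)) mT := fun n =>
    (UniformSpace.Completion.continuous_coe _).comp_aestronglyMeasurable
      (φ n).aestronglyMeasurable
  have hd : ∀ n, AEStronglyMeasurable (fun t => f t - (φ n t : τ.L1)) mT := fun n =>
    (Lp.aestronglyMeasurable f).sub (hφ n)
  have key : ∀ n, eLpNorm (traceMulFun τ m f) 2 mT ≤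
      ‖τ.traceMul m‖ₑ * eLpNorm (fun t => f t - (φ n t : τ.L1)) 2 mT + simpleNorm τ s (φ n) := by
    intro n
    have e : traceMulFun τ m f =ᵐ[mT] (fun t => τ.traceMul m (f t - (φ n t : τ.L1))) +
        fun t => τ.traceMulS m (φ n t) := by
      filter_upwards [(τ.traceMul m).coeFn_compLp f] with t ht
      rw [traceMulFun, ht, Pi.add_apply, map_sub, traceMul_coe_eq, sub_add_cancel]
    rw [eLpNorm_congr_ae e]
    refine (eLpNorm_add_le ((τ.traceMul m).continuous.comp_aestronglyMeasurable (hd n))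
      ((τ.traceMulS m).continuous.comp_aestronglyMeasurable (φ n).aestronglyMeasurable)
      one_le_two).trans ?_
    exact add_le_add (eLpNorm_clm_comp_le _ _ _) (eLpNorm_traceMulS_le s (φ n) hm)
  have hlim := (ENNReal.Tendsto.const_mul h1 (Or.inr enorm_ne_top :
    (0 : ℝ≥0∞) ≠ 0 ∨ ‖τ.traceMul m‖ₑ ≠ ⊤)).add h2
  rw [mul_zero, zero_add] at hlim
  exact ge_of_tendsto' hlim key

theorem eLpNorm_traceMulFun_le_normL1L2 (s : Side) (f : Lp τ.L1 1 mT) {m : M} (hm : ‖m‖ ≤ 1) :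
    eLpNorm (traceMulFun τ m f) 2 mT ≤ normL1L2 τ s f :=
  le_iInf fun _ => le_iInf fun h => h.eLpNorm_traceMulFun_le hm

/-- The arc is unchanged: support and zero mean survive any bounded functional, and the size
condition is the `L²` bound for contractions. -/
theorem IsAtom.traceMulFun {s : Side} {a : Lp τ.L1 1 mT} (ha : IsAtom τ s a) {m : M}
    (hm : ‖m‖ ≤ 1) : IsScalarAtom (traceMulFun τ m a) := by
  obtain ⟨-, c, r, hr, hsupp, hint, hnorm⟩ := ha
  have e := (τ.traceMul m).coeFn_compLp a
  refine ⟨c, r, hr, ?_, ?_, (eLpNorm_traceMulFun_le_normL1L2 s a hm).trans hnorm⟩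
  · filter_upwards [e, hsupp] with t ht ht' hmem
    rw [OpHardy.traceMulFun, ht, ht' hmem, map_zero]
  · have hi : Integrable a mT := L1.integrable_coeFn a
    rw [OpHardy.traceMulFun, integral_congr_ae (ae_restrict_of_ae e),
      (τ.traceMul m).integral_comp_comm hi.integrableOn, hint, map_zero]

theorem norm_traceMul_le (m : M) (x : τ.L1) : ‖τ.traceMul m x‖ ≤ ‖m‖ * ‖x‖ := by
  induction x using UniformSpace.Completion.induction_on with
  | hp => exact isClosed_le (by fun_prop) (by fun_prop)
  | ih x =>
    rw [traceMul_coe_eq, UniformSpace.Completion.norm_coe]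
    exact NSFTrace.lin_mul_le_abs x.val_mem m

theorem traceMul_smul (c : ℂ) (m : M) : τ.traceMul (c • m) = c • τ.traceMul m := by
  ext x
  induction x using UniformSpace.Completion.induction_on with
  | hp => exact isClosed_eq (by fun_prop) (by fun_prop)
  | ih x =>
    rw [_root_.smul_apply, τ.traceMul_coe, τ.traceMul_coe, smul_mul_assoc,
      NSFTrace.lin_smul _ (NSFTrace.mul_mem_defIdeal m x.val_mem), smul_eq_mul]

theorem traceMulFun_mem_scalarAtoms {s : Side} {a : Lp τ.L1 1 mT} (ha : a ∈ opAtoms τ s) {m : M}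
    (hm : ‖m‖ ≤ 1) : traceMulFun τ m a ∈ scalarAtoms := by
  rcases ha with ha | ⟨x, hx, ha⟩
  · exact Or.inl (ha.traceMulFun hm)
  · refine Or.inr ⟨τ.traceMul m x, ?_, ?_⟩
    · exact ((norm_traceMul_le m x).trans
        (mul_le_of_le_one_left (norm_nonneg _) hm)).trans_lt hx
    · filter_upwards [ha, (τ.traceMul m).coeFn_compLp a] with t ht ht'
      rw [traceMulFun, ht', ht]

/-- `f ↦ τ (m f)` maps the column (row) Hardy space into the scalar one, with norm at most `‖m‖`. -/
theorem traceMulFun_mem_scalarH1 (m : M) {s : Side} {f : Lp τ.L1 1 mT}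
    (hf : f ∈ atomicSpace (opAtoms τ s)) : traceMulFun τ m f ∈ scalarH1 ∧
      scalarH1Norm (traceMulFun τ m f) ≤ ‖m‖ₑ * opH1Norm τ s f := by
  -- The size bounds on atoms and constants are preserved by contractions, so the norm of `m` is
  -- moved into a scalar factor outside the decomposition.
  obtain ⟨v, hv, e⟩ : ∃ v : M, ‖v‖ ≤ 1 ∧ (‖m‖ : ℂ) • v = m := by
    by_cases hm : m = 0
    · exact ⟨0, by simp, by simp [hm]⟩
    · have : (‖m‖ : ℂ) ≠ 0 := by simpa using hm
      exact ⟨(‖m‖ : ℂ)⁻¹ • m, by rw [norm_smul]; simp [hm],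
        by rw [smul_smul, mul_inv_cancel₀ this, one_smul]⟩
  have hT : ∀ a ∈ opAtoms τ s, (τ.traceMul v).compLpL 1 mT a ∈ scalarAtoms := fun a ha =>
    traceMulFun_mem_scalarAtoms ha hv
  have e2 : traceMulFun τ m f = (‖m‖ : ℂ) • (τ.traceMul v).compLpL 1 mT f := by
    nth_rewrite 1 [← e]
    rw [traceMulFun, traceMul_smul, ContinuousLinearMap.smul_compLp]
    rfl
  have hmem := map_mem_atomicSpace _ hT hf
  rw [e2]
  refine ⟨smul_mem_atomicSpace hmem _, (atomicNorm_smul_le hmem _).trans ?_⟩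
  have : ‖(‖m‖ : ℂ)‖ₑ = ‖m‖ₑ := by
    rw [← ofReal_norm, Complex.norm_real, norm_norm, ofReal_norm]
  rw [this]
  gcongr
  exact atomicNorm_map_le _ hT f

/-- A bounded functional passes under the Bochner integral; this is how analyticity of `P[f]` is
inherited by the scalar function. -/
theorem poissonIntegral_traceMulFun (m : M) (f : Lp τ.L1 1 mT) {z : ℂ} (hz : ‖z‖ < 1) :
    poissonIntegral (traceMulFun τ m f) z = τ.traceMul m (poissonIntegral f z) := by
  unfold poissonIntegral
  rw [← (τ.traceMul m).integral_comp_comm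
    (integrable_poissonKernel_smul hz (L1.integrable_coeFn f))]
  refine integral_congr_ae ?_
  filter_upwards [(τ.traceMul m).coeFn_compLp f] with t ht
  -- The kernel acts by real scalars; they are read as complex ones to use complex linearity.
  rw [traceMulFun, ht, ← Complex.coe_smul, ← Complex.coe_smul, map_smul]

theorem poissonIntegral_add {E : Type*} [NormedAddCommGroup E] [NormedSpace ℂ E]
    (f g : Lp E 1 mT) {z : ℂ} (hz : ‖z‖ < 1) :
    poissonIntegral (f + g : Lp E 1 mT) z = poissonIntegral f z + poissonIntegral g z := by
  unfold poissonIntegral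
  rw [← integral_add (integrable_poissonKernel_smul hz (L1.integrable_coeFn f))
    (integrable_poissonKernel_smul hz (L1.integrable_coeFn g))]
  refine integral_congr_ae ?_
  filter_upwards [Lp.coeFn_add f g] with t ht
  rw [ht, Pi.add_apply, smul_add]

theorem analyticInDisc_poissonIntegral_traceMulFun (m : M) {f : Lp τ.L1 1 mT}
    (hf : f ∈ hardyCR τ) : AnalyticInDisc (poissonIntegral (traceMulFun τ m f)) := by
  obtain ⟨g, ⟨-, c, hc⟩, h, ⟨-, d, hd⟩, rfl⟩ := hf
  refine ⟨fun n => τ.traceMul m (c n + d n), fun z hz => ?_⟩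
  rw [poissonIntegral_traceMulFun m _ hz, poissonIntegral_add g h hz]
  simpa [mul_add] using (τ.traceMul m).hasSum ((hc z hz).add (hd z hz))

theorem traceMulFun_add (m : M) (f g : Lp τ.L1 1 mT) :
    traceMulFun τ m (f + g) = traceMulFun τ m f + traceMulFun τ m g :=
  map_add ((τ.traceMul m).compLpL 1 mT) f g

theorem traceMulFun_hardyCR (m : M) {f : Lp τ.L1 1 mT} (hf : f ∈ hardyCR τ) :
    traceMulFun τ m f ∈ scalarH1 ∧
      scalarH1Norm (traceMulFun τ m f) ≤ ‖m‖ₑ * hardyCRNorm τ f := by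
  constructor
  · obtain ⟨g, hg, h, hh, rfl⟩ := hf
    rw [traceMulFun_add]
    exact add_mem_atomicSpace (traceMulFun_mem_scalarH1 m hg.1).1
      (traceMulFun_mem_scalarH1 m hh.1).1
  · have key : ∀ g ∈ analyticH1 τ Side.col, ∀ h ∈ analyticH1 τ Side.row, f = g + h →
        scalarH1Norm (traceMulFun τ m f) ≤
          ‖m‖ₑ * (opH1Norm τ Side.col g + opH1Norm τ Side.row h) := by
      rintro g hg h hh rfl
      rw [traceMulFun_add, mul_add]
      exact (atomicNorm_add_le _ _ _).trans (add_le_add (traceMulFun_mem_scalarH1 m hg.1).2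
        (traceMulFun_mem_scalarH1 m hh.1).2)
    -- A factor `0` need not commute with an infimum in `[0, ∞]`. For `m = 0` the one splitting
    -- provided by `hf` already gives the bound `0`.
    by_cases hm : ‖m‖ₑ = 0
    · obtain ⟨g, hg, h, hh, e⟩ := hf
      simpa [hm] using key g hg h hh e
    · simp only [hardyCRNorm, ENNReal.mul_iInf_of_ne hm enorm_ne_top]
      exact le_iInf₂ fun g hg => le_iInf₂ fun h hh => le_iInf fun e => key g hg h hh e

theorem atomicNorm_lt_top {E : Type*} [NormedAddCommGroup E] [NormedSpace ℂ E] {A : Set E} {f : E}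
    (hf : f ∈ atomicSpace A) : atomicNorm A f < ⊤ := by
  obtain ⟨l, a, h⟩ := hf
  refine h.atomicNorm_le.trans_lt ?_
  simp only [← ofReal_norm]
  exact h.summable.tsum_ofReal_lt_top

end Main

end OpHardy

theorem proposition3p2 {M : Type*} [CStarAlgebra M] [PartialOrder M] [StarOrderedRing M]
    [WStarAlgebra M] (τ : OpHardy.NSFTrace M)
    (f : MeasureTheory.Lp τ.L1 1 OpHardy.mT) (hf : f ∈ OpHardy.hardyCR τ) (m : M) :
    OpHardy.traceMulFun τ m f ∈ OpHardy.scalarH1 ∧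
    OpHardy.MemDiscHardy (OpHardy.poissonIntegral (OpHardy.traceMulFun τ m f)) ∧
    OpHardy.scalarH1Norm (OpHardy.traceMulFun τ m f) ≤ ‖m‖ₑ * OpHardy.hardyCRNorm τ f ∧
    OpHardy.discHardyNorm (OpHardy.poissonIntegral (OpHardy.traceMulFun τ m f)) ≤
      ‖m‖ₑ * OpHardy.hardyCRNorm τ f := by
  obtain ⟨hmem, hnorm⟩ := OpHardy.traceMulFun_hardyCR m hf
  -- The `L¹` norm lies between the two norms with constant `1` on each side, so the disc estimate
  -- follows from the atomic one without loss.
  have hle : OpHardy.discHardyNorm (OpHardy.poissonIntegral (OpHardy.traceMulFun τ m f)) ≤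
      OpHardy.scalarH1Norm (OpHardy.traceMulFun τ m f) :=
    (OpHardy.discHardyNorm_poissonIntegral_le _).trans
      (OpHardy.enorm_le_atomicNorm (fun _ => OpHardy.enorm_le_one_of_mem_scalarAtoms) _)
  exact ⟨hmem, ⟨(OpHardy.analyticInDisc_poissonIntegral_traceMulFun m hf).differentiableOn,
    hle.trans_lt (OpHardy.atomicNorm_lt_top hmem)⟩, hnorm, hle.trans hnorm⟩
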